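/- Let $G=(V,E)$ be a finite simple graph with $n$ vertices and $m$ edges. A *forest* is an acyclic graph, a *linear forest* is a forest all of whose connected components are paths (isolated vertices included), and a *pseudoforest* is a graph in which each connected component contains at most one cycle. There is an algorithm which, given $G$ together with a partition $E=P_1\mathbin{\dot\cup}P_2\mathbin{\dot\cup}P_3$ of its edge set such that each $(V,P_i)$ is a pseudoforest, computes a partition $E=F_1\mathbin{\dot\cup}F_2\mathbin{\dot\cup}F_3\mathbin{\dot\cup}F_4\mathbin{\dot\cup}F_5$ of its edge set (parts may be empty) such that each $(V,F_j)$ is a forest and $(V,F_4)$ and $(V,F_5)$ are linear forests. The algorithm runs in linear time, that is, in at most $C\,(n+m+1)$ steps for an absolute constant $C$. Here $V=\{0,\dots,n-1\}$, the input consists of $n$, $m$ and an arbitrarily ordered list of the $m$ edges, each given by its two end vertices and the index of the part $P_i$ containing it, the output consists of the index of the part $F_j$ containing each listed edge, and steps are counted on a random access machine at unit cost whose only arithmetic operations are increment, decrement and comparison. -/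

import Mathlib

namespace PseudoConv

/-! ### Graphs -/

section Graphs

variable {V : Type*}

/-- Every connected component contains at most one cycle: two closed walks that are cycles and lie
in the same component trace out the same cycle (as a subgraph). -/
def IsPseudoforest (G : SimpleGraph V) : Prop :=
  ∀ ⦃u v : V⦄ (p : G.Walk u u) (q : G.Walk v v),
    p.IsCycle → q.IsCycle → G.Reachable u v → p.toSubgraph = q.toSubgraph

/-- A forest all of whose connected components are paths (a single vertex is a path). -/
def IsLinearForest (G : SimpleGraph V) : Prop :=
  G.IsAcyclic ∧ ∀ c : G.ConnectedComponent, ∃ (u v : V) (p : G.Walk u v),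
    p.IsPath ∧ p.toSubgraph = (⊤ : G.Subgraph).induce c.supp

/-- The edge set of `G` is the disjoint union of the edge sets of `H 0, …, H (k - 1)`, which are
regarded as graphs on the vertex set of `G`; parts may be empty. -/
structure IsEdgePartition {k : ℕ} (G : SimpleGraph V) (H : Fin k → SimpleGraph V) : Prop where
  le : ∀ i, H i ≤ G
  existsUnique : ∀ u v, G.Adj u v → ∃! i, (H i).Adj u v

end Graphs

/-! ### A random access machine

Programs are while-programs over finitely many registers and finitely many arrays, all holding
natural numbers. The only arithmetic is adding and subtracting `1`, so within `t` steps no number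
can exceed the largest input number and program constant by more than `t`: a linear-time run only
uses words of `log₂ (input size) + O(1)` bits. Each elementary operation (constant, register access,
array access at a computed index, increment, decrement, comparison, Boolean connective, assignment,
branch) costs one step. -/

/-- Contents of the registers and of the arrays. -/
structure Store where
  reg : ℕ → ℕ
  arr : ℕ → ℕ → ℕ

/-- Write a register. -/
def Store.setReg (s : Store) (r x : ℕ) : Store :=
  { s with reg := Function.update s.reg r x }

/-- Write cell `i` of array `a`. -/
def Store.setArr (s : Store) (a i x : ℕ) : Store :=
  { s with arr := Function.update s.arr a (Function.update (s.arr a) i x) }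

inductive Expr where
  | const (k : ℕ)
  | reg (r : ℕ)
  | succ (e : Expr)
  | pred (e : Expr)
  /-- the content of array `a` at the index given by the value of `e` -/
  | read (a : ℕ) (e : Expr)

namespace Expr

def eval (s : Store) : Expr → ℕ
  | const k => k
  | reg r => s.reg r
  | succ e => e.eval s + 1
  | pred e => e.eval s - 1
  | read a e => s.arr a (e.eval s)

def cost : Expr → ℕ
  | const _ => 1
  | reg _ => 1
  | succ e => e.cost + 1
  | pred e => e.cost + 1
  | read _ e => e.cost + 1

end Expr

inductive Test where
  | eq (e f : Expr)
  | lt (e f : Expr)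
  | not (b : Test)
  | and (b c : Test)

namespace Test

def Holds (s : Store) : Test → Prop
  | eq e f => e.eval s = f.eval s
  | lt e f => e.eval s < f.eval s
  | not b => ¬ b.Holds s
  | and b c => b.Holds s ∧ c.Holds s

def cost : Test → ℕ
  | eq e f => e.cost + f.cost + 1
  | lt e f => e.cost + f.cost + 1
  | not b => b.cost + 1
  | and b c => b.cost + c.cost + 1

end Test

inductive Prog where
  | skip
  | assign (r : ℕ) (e : Expr)
  /-- array `a` at index `i` receives the value of `e` -/
  | write (a : ℕ) (i e : Expr)
  | seq (p q : Prog)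
  | ite (b : Test) (p q : Prog)
  /-- while `b` holds, execute `p` -/
  | loop (b : Test) (p : Prog)

/-- `Exec p s t s'`: started in `s`, the program `p` halts after exactly `t` steps in `s'`. -/
inductive Exec : Prog → Store → ℕ → Store → Prop where
  | skip (s : Store) : Exec .skip s 1 s
  | assign (r : ℕ) (e : Expr) (s : Store) :
      Exec (.assign r e) s (e.cost + 1) (s.setReg r (e.eval s))
  | write (a : ℕ) (i e : Expr) (s : Store) :
      Exec (.write a i e) s (i.cost + e.cost + 1) (s.setArr a (i.eval s) (e.eval s))
  | seq {p q : Prog} {s s' s'' : Store} {t t' : ℕ} :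
      Exec p s t s' → Exec q s' t' s'' → Exec (.seq p q) s (t + t') s''
  | ite_true {b : Test} {p q : Prog} {s s' : Store} {t : ℕ} :
      b.Holds s → Exec p s t s' → Exec (.ite b p q) s (b.cost + 1 + t) s'
  | ite_false {b : Test} {p q : Prog} {s s' : Store} {t : ℕ} :
      ¬ b.Holds s → Exec q s t s' → Exec (.ite b p q) s (b.cost + 1 + t) s'
  | loop_done {b : Test} {p : Prog} {s : Store} :
      ¬ b.Holds s → Exec (.loop b p) s (b.cost + 1) s
  | loop_step {b : Test} {p : Prog} {s s' s'' : Store} {t t' : ℕ} :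
      b.Holds s → Exec p s t s' → Exec (.loop b p) s' t' s'' →
      Exec (.loop b p) s (b.cost + 1 + t + t') s''

/-! ### Representation of edge-partitioned graphs -/

/-- The pairs `{src e, dst e}`, `e < m`, list every edge of `G` exactly once (in any order and with
any order of the two end vertices). -/
structure IsEdgeList {n m : ℕ} (G : SimpleGraph (Fin n)) (src dst : Fin m → Fin n) : Prop where
  adj : ∀ e, G.Adj (src e) (dst e)
  existsUnique : ∀ x ∈ G.edgeSet, ∃! e, s(src e, dst e) = x

/-- `lab` assigns to each listed edge the index of the part that contains it. -/
def IsLabelling {n m k : ℕ} (H : Fin k → SimpleGraph (Fin n)) (src dst : Fin m → Fin n)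
    (lab : Fin m → ℕ) : Prop :=
  ∀ (e : Fin m) (i : Fin k), lab e = (i : ℕ) ↔ (H i).Adj (src e) (dst e)

/-- An array with the given first `m` entries, and `0` elsewhere. -/
def toArr {m : ℕ} (f : Fin m → ℕ) : ℕ → ℕ :=
  fun i => if h : i < m then f ⟨i, h⟩ else 0

/-- The initial store: registers `0` and `1` hold the numbers of vertices and of edges, arrays `0`,
`1`, `2` hold the end vertices and the labels of the edges, and everything else is `0`. -/
def inputStore {n m : ℕ} (src dst : Fin m → Fin n) (lab : Fin m → ℕ) : Store where
  reg := fun r => match r with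
    | 0 => n
    | 1 => m
    | _ => 0
  arr := fun a => match a with
    | 0 => toArr fun e => (src e : ℕ)
    | 1 => toArr fun e => (dst e : ℕ)
    | 2 => toArr lab
    | _ => fun _ => 0

/-- The labels that a program leaves in array `3`. -/
def outputLabels (m : ℕ) (s : Store) : Fin m → ℕ :=
  fun e => s.arr 3 (e : ℕ)

end PseudoConv

/-! In each pseudoforest, a graph search gives a spanning forest and an order of discovery of the
vertices. A component with at most one cycle has at most one edge outside the spanning forest, its
chord (`IsPseudoforest.chord_unique`). Taking one suitable edge out of each component with a chord
leaves a forest. The task is to choose these edges so that together they form two linear forests.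

From the third pseudoforest the chords themselves are taken out. They lie in different components,
so no two share a vertex: they form a matching, which is part `4`.

The edges taken out of the first two pseudoforests all go to part `3`. At most one comes from each
component of either pseudoforest, so degrees are at most two and only cycles have to be avoided. Let
the chord join `v` to an earlier vertex `u`, and let `w` be the parent of `v`; then `w ≠ u`. Either
`vu` or `vw` can be taken out: in the second case the chord replaces `vw` as the only edge from `v`
to an earlier vertex, and a graph in which no vertex has two edges to earlier vertices has no cycle
(`isAcyclic_of_top`, `SearchResult.isAcyclic`). As long as the component is untreated, its vertices
meet only edges that part `3` received from the other pseudoforest, hence at most one each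
(`ChordInv.low`). So `u`, `v`, `w` are ends of paths in part `3`, possibly of one-vertex paths. If
`vu` would close a cycle, then `u` is the other end of the path of `v`, so `w` is not, and `vw` is
safe (`ChordInv.swap`).

For linear time, an array stores for each end of a path the opposite end: testing for a cycle is one
lookup and joining two paths takes two writes (`PathEnds.join`). Each search is charged to a
linearly bounded potential that drops in every round. Loops are verified by `Runs.loop`; their
bodies are loop-free and thus take constant time. -/

namespace PseudoConv

open SimpleGraph

/-! ### Reasoning about programs -/

/-- `p`, started in `s`, halts after at most `B` steps in a store satisfying `Q`. -/
def Runs (p : Prog) (s : Store) (B : ℕ) (Q : Store → Prop) : Prop :=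
  ∃ t s', Exec p s t s' ∧ t ≤ B ∧ Q s'

theorem Runs.mono {p : Prog} {s : Store} {B B' : ℕ} {Q Q' : Store → Prop} (h : Runs p s B Q)
    (hB : B ≤ B') (hQ : ∀ s', Q s' → Q' s') : Runs p s B' Q' := by
  obtain ⟨t, s', he, ht, hq⟩ := h
  exact ⟨t, s', he, ht.trans hB, hQ _ hq⟩

theorem Runs.seq {p q : Prog} {s : Store} {B B' : ℕ} {Q Q' : Store → Prop} (h : Runs p s B Q)
    (h' : ∀ s', Q s' → Runs q s' B' Q') : Runs (.seq p q) s (B + B') Q' := by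
  obtain ⟨t, s', he, ht, hq⟩ := h
  obtain ⟨t', s'', he', ht', hq'⟩ := h' s' hq
  exact ⟨t + t', s'', .seq he he', by omega, hq'⟩

/-- Array `a` is written somewhere in the program. -/
def Prog.Writes (a : ℕ) : Prog → Prop
  | skip => False
  | assign _ _ => False
  | write a' _ _ => a = a'
  | seq p q => p.Writes a ∨ q.Writes a
  | ite _ p q => p.Writes a ∨ q.Writes a
  | loop _ p => p.Writes a

/-- Register `r` is assigned somewhere in the program. -/
def Prog.Assigns (r : ℕ) : Prog → Prop
  | skip => False
  | assign r' _ => r = r'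
  | write _ _ _ => False
  | seq p q => p.Assigns r ∨ q.Assigns r
  | ite _ p q => p.Assigns r ∨ q.Assigns r
  | loop _ p => p.Assigns r

/-- `s'` differs from `s` only where `p` can make changes. -/
structure Frame (p : Prog) (s s' : Store) : Prop where
  arr : ∀ a, ¬ p.Writes a → s'.arr a = s.arr a
  reg : ∀ r, ¬ p.Assigns r → s'.reg r = s.reg r

theorem Frame.refl (p : Prog) (s : Store) : Frame p s s := ⟨fun _ _ => rfl, fun _ _ => rfl⟩

theorem Frame.trans {p : Prog} {s s' s'' : Store} (h : Frame p s s') (h' : Frame p s' s'') :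
    Frame p s s'' :=
  ⟨fun a ha => (h'.arr a ha).trans (h.arr a ha), fun r hr => (h'.reg r hr).trans (h.reg r hr)⟩

theorem Frame.mono {p q : Prog} {s s' : Store} (h : Frame p s s')
    (hw : ∀ a, p.Writes a → q.Writes a) (ha : ∀ r, p.Assigns r → q.Assigns r) : Frame q s s' :=
  ⟨fun a h' => h.arr a (mt (hw a) h'), fun r h' => h.reg r (mt (ha r) h')⟩

theorem Exec.frame {p : Prog} {s s' : Store} {t : ℕ} (h : Exec p s t s') : Frame p s s' := by
  induction h with
  | skip s => exact .refl _ s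
  | assign r e s =>
    refine ⟨fun _ _ => rfl, fun r' hr => ?_⟩
    simp only [Store.setReg]
    exact Function.update_of_ne hr _ _
  | write a i e s =>
    refine ⟨fun a' ha => ?_, fun _ _ => rfl⟩
    simp only [Store.setArr]
    exact Function.update_of_ne ha _ _
  | seq _ _ ih ih' =>
    exact Frame.trans (p := .seq _ _) (ih.mono (fun _ => Or.inl) (fun _ => Or.inl))
      (ih'.mono (fun _ => Or.inr) (fun _ => Or.inr))
  | ite_true _ _ ih => exact ih.mono (fun _ => Or.inl) (fun _ => Or.inl)
  | ite_false _ _ ih => exact ih.mono (fun _ => Or.inr) (fun _ => Or.inr)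
  | loop_done _ => exact .refl _ _
  | loop_step _ _ _ ih ih' => exact Frame.trans (p := .loop _ _) (ih.mono (fun _ => id) (fun _ => id)) ih'

theorem Runs.frame {p : Prog} {s : Store} {B : ℕ} {Q : Store → Prop} (h : Runs p s B Q) :
    Runs p s B fun s' => Q s' ∧ Frame p s s' := by
  obtain ⟨t, s', he, ht, hq⟩ := h
  exact ⟨t, s', he, ht, hq, he.frame⟩

/-- Total correctness of a loop with invariant `Inv`, whose first argument is a bound on the number
of remaining iterations. -/
theorem Runs.loop {b : Test} {p : Prog} {K : ℕ} {Inv : ℕ → Store → Prop} {s₀ : Store}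
    (hstep : ∀ v s, Frame p s₀ s → Inv v s → b.Holds s →
      Runs p s K fun s' => ∃ v' < v, Inv v' s')
    {v : ℕ} (h : Inv v s₀) :
    Runs (.loop b p) s₀ ((b.cost + 1 + K) * (v + 1)) fun s' =>
      ¬ b.Holds s' ∧ Frame p s₀ s' ∧ ∃ v', Inv v' s' := by
  suffices H : ∀ v s, Frame p s₀ s → Inv v s →
      Runs (.loop b p) s ((b.cost + 1 + K) * (v + 1)) fun s' =>
        ¬ b.Holds s' ∧ Frame p s₀ s' ∧ ∃ v', Inv v' s' from H v s₀ (.refl _ _) h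
  intro v
  induction v using Nat.strong_induction_on with
  | _ v ih =>
    intro s hf h
    have h2 : (b.cost + 1 + K) * (v + 1) = (b.cost + 1 + K) * v + (b.cost + 1 + K) := by ring
    by_cases hb : b.Holds s
    · obtain ⟨t, s', he, ht, v', hv', hi⟩ := hstep v s hf h hb
      obtain ⟨t', s'', he', ht', hq⟩ := ih v' hv' s' (hf.trans he.frame) hi
      refine ⟨_, s'', .loop_step hb he he', ?_, hq⟩
      -- Since `v' < v`, the remaining run fits into `v` rounds, which leaves one round for the
      -- iteration just made.
      have h1 : (b.cost + 1 + K) * (v' + 1) ≤ (b.cost + 1 + K) * v := Nat.mul_le_mul_left _ hv'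
      omega
    · exact ⟨_, s, .loop_done hb, by omega, hb, hf, v, h⟩

/-! ### Loop-free programs as functions on stores with a constant time bound -/

namespace Prog

/-- No `loop` occurs in the program. -/
def LoopFree : Prog → Prop
  | skip => True
  | assign _ _ => True
  | write _ _ _ => True
  | seq p q => p.LoopFree ∧ q.LoopFree
  | ite _ p q => p.LoopFree ∧ q.LoopFree
  | loop _ _ => False

open Classical in
/-- The effect of a loop-free program. -/
noncomputable def run : Prog → Store → Store
  | skip, s => s
  | assign r e, s => s.setReg r (e.eval s)
  | write a i e, s => s.setArr a (i.eval s) (e.eval s)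
  | seq p q, s => q.run (p.run s)
  | ite b p q, s => if b.Holds s then p.run s else q.run s
  | loop _ _, s => s

/-- An upper bound on the running time of a loop-free program. -/
def bound : Prog → ℕ
  | skip => 1
  | assign _ e => e.cost + 1
  | write _ i e => i.cost + e.cost + 1
  | seq p q => p.bound + q.bound
  | ite b p q => b.cost + 1 + (p.bound + q.bound)
  | loop _ _ => 0

theorem LoopFree.exec {p : Prog} (hp : p.LoopFree) (s : Store) :
    ∃ t ≤ p.bound, Exec p s t (p.run s) := by
  induction p generalizing s with
  | skip => exact ⟨_, le_rfl, .skip s⟩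
  | assign r e => exact ⟨_, le_rfl, .assign r e s⟩
  | write a i e => exact ⟨_, le_rfl, .write a i e s⟩
  | seq p q ihp ihq =>
    obtain ⟨t, ht, h⟩ := ihp hp.1 s
    obtain ⟨t', ht', h'⟩ := ihq hp.2 (p.run s)
    exact ⟨_, Nat.add_le_add ht ht', .seq h h'⟩
  | ite b p q ihp ihq =>
    by_cases hb : b.Holds s
    · obtain ⟨t, ht, h⟩ := ihp hp.1 s
      refine ⟨_, ?_, by simpa [run, hb] using Exec.ite_true hb h⟩
      simp only [bound]; omega
    · obtain ⟨t, ht, h⟩ := ihq hp.2 s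
      refine ⟨_, ?_, by simpa [run, hb] using Exec.ite_false hb h⟩
      simp only [bound]; omega
  | loop b p => exact hp.elim

theorem LoopFree.runs {p : Prog} (hp : p.LoopFree) {s : Store} {Q : Store → Prop}
    (h : Q (p.run s)) : Runs p s p.bound Q := by
  obtain ⟨t, ht, he⟩ := hp.exec s
  exact ⟨t, _, he, ht, h⟩

end Prog

@[simp] theorem Store.reg_setReg (s : Store) (r x r' : ℕ) :
    (s.setReg r x).reg r' = if r' = r then x else s.reg r' := by
  simp [Store.setReg, Function.update_apply]

@[simp] theorem Store.arr_setReg (s : Store) (r x : ℕ) : (s.setReg r x).arr = s.arr := rfl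

@[simp] theorem Store.reg_setArr (s : Store) (a i x : ℕ) : (s.setArr a i x).reg = s.reg := rfl

@[simp] theorem Store.arr_setArr (s : Store) (a i x a' : ℕ) :
    (s.setArr a i x).arr a' = if a' = a then Function.update (s.arr a) i x else s.arr a' := by
  by_cases h : a' = a <;> simp [Store.setArr, h]

/-! ### Spanning forests, acyclicity and linear forests -/

section GraphLemmas

variable {V E : Type*}

/-- The graph whose edges are the pairs `{src e, dst e}`, `e ∈ S`. -/
def edgeGraph (src dst : E → V) (S : Set E) : SimpleGraph V where
  Adj x y := x ≠ y ∧ ∃ e ∈ S, s(src e, dst e) = s(x, y)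
  symm := ⟨fun x y h => ⟨h.1.symm, by simpa [Sym2.eq_swap] using h.2⟩⟩
  loopless := ⟨fun x h => h.1 rfl⟩

theorem edgeGraph_adj {src dst : E → V} {S : Set E} {x y : V} :
    (edgeGraph src dst S).Adj x y ↔ x ≠ y ∧ ∃ e ∈ S, s(src e, dst e) = s(x, y) := Iff.rfl

theorem edgeGraph_mono {src dst : E → V} {S S' : Set E} (h : S ⊆ S') :
    edgeGraph src dst S ≤ edgeGraph src dst S' := by
  rintro x y ⟨hne, e, he, hs⟩
  exact ⟨hne, e, h he, hs⟩

theorem edgeGraph_adj_of_mem {src dst : E → V} (hne : ∀ e, src e ≠ dst e) {S : Set E} {e : E}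
    (he : e ∈ S) {x y : V} (h : s(src e, dst e) = s(x, y)) : (edgeGraph src dst S).Adj x y := by
  refine ⟨?_, e, he, h⟩
  rintro rfl
  have := hne e
  simp at h
  exact this (h.1.trans h.2.symm)

theorem edgeGraph_insert {src dst : E → V} (S : Set E) (e : E) :
    edgeGraph src dst (insert e S) = edgeGraph src dst S ⊔ edge (src e) (dst e) := by
  ext x y
  by_cases hxy : x = y <;>
    simp [edgeGraph_adj, sup_adj, adj_edge, -Sym2.eq, hxy, or_comm]

/-- If distinct edges have distinct upper end vertices then there are no cycles. -/
theorem isAcyclic_of_top {H : SimpleGraph V} (ord : V → ℕ) (hord : ∀ x y, H.Adj x y → ord x ≠ ord y)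
    (htop : ∀ v x y, H.Adj v x → H.Adj v y → ord x < ord v → ord y < ord v → x = y) :
    H.IsAcyclic := by
  classical
  intro u p hp
  -- At the vertex of the cycle with largest `ord`, both neighbours on the cycle lie below it.
  obtain ⟨v, hv, hmax⟩ := p.support.toFinset.exists_max_image ord ⟨u, by simp⟩
  simp only [List.mem_toFinset] at hv hmax
  have h2 := hp.ncard_neighborSet_toSubgraph_eq_two hv
  obtain ⟨x, y, hxy, hs⟩ := Set.ncard_eq_two.1 h2
  have hlt : ∀ z, z ∈ p.toSubgraph.neighborSet v → H.Adj v z ∧ ord z < ord v := by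
    intro z hz
    have hadj : p.toSubgraph.Adj v z := hz
    have h := hmax z ((Walk.mem_verts_toSubgraph p).1 hadj.snd_mem)
    exact ⟨hadj.adj_sub, lt_of_le_of_ne h (hord _ _ hadj.adj_sub).symm⟩
  have hx := hlt x (by simp [hs])
  have hy := hlt y (by simp [hs])
  exact hxy (htop v x y hx.1 hy.1 hx.2 hy.2)

/-- In a pseudoforest, a component has at most one edge outside a spanning forest. -/
theorem IsPseudoforest.chord_unique {P T : SimpleGraph V} (hP : IsPseudoforest P) (hTP : T ≤ P)
    (hspan : ∀ x y, P.Reachable x y → T.Reachable x y) {u v u' v' : V}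
    (huv : P.Adj u v) (hT : ¬ T.Adj u v) (huv' : P.Adj u' v') (hT' : ¬ T.Adj u' v')
    (h : P.Reachable u u') : s(u, v) = s(u', v') := by
  classical
  -- The fundamental cycle of a chord: close it by a path of `T`, so that the chord is the only edge
  -- of the cycle outside `T`.
  have cyc : ∀ {u v : V}, P.Adj u v → ¬ T.Adj u v → ∃ p : P.Walk u u, p.IsCycle ∧
      ∀ x, x ∈ p.edges ↔ x = s(u, v) ∨ (x ∈ p.edges ∧ x ∈ T.edgeSet) := by
    intro u v huv hT
    obtain ⟨q, hq⟩ := (hspan v u huv.symm.reachable).exists_isPath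
    have hqe : ∀ x ∈ q.edges, x ∈ T.edgeSet := fun x hx => q.edges_subset_edgeSet hx
    refine ⟨Walk.cons huv (q.mapLe hTP), ?_, ?_⟩
    · rw [Walk.cons_isCycle_iff]
      refine ⟨(Walk.isPath_mapLe hTP).2 hq, fun hmem => hT ?_⟩
      rw [Walk.edges_mapLe_eq_edges] at hmem
      exact hqe _ hmem
    · intro x
      rw [Walk.edges_cons, Walk.edges_mapLe_eq_edges, List.mem_cons]
      constructor
      · rintro (h | h)
        · exact .inl h
        · exact .inr ⟨.inr h, hqe _ h⟩
      · rintro (h | h)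
        · exact .inl h
        · exact h.1
  obtain ⟨p, hp, hpe⟩ := cyc huv hT
  obtain ⟨q, hq, hqe⟩ := cyc huv' hT'
  have heq := hP p q hp hq h
  -- Both fundamental cycles have the same edges, so the first chord lies on the second cycle; not
  -- being in `T`, it must be the second chord.
  have h1 : s(u, v) ∈ p.edges := (hpe _).2 (.inl rfl)
  rw [← Walk.mem_edges_toSubgraph, heq, Walk.mem_edges_toSubgraph, hqe] at h1
  rcases h1 with h1 | h1
  · exact h1
  · exact absurd h1.2 hT

/-- At most one edge of `H` at `x`. -/
def Low (H : SimpleGraph V) (x : V) : Prop := ∀ y z, H.Adj x y → H.Adj x z → y = z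

/-- Any three neighbours of a vertex are not distinct. -/
def DegLeTwo (H : SimpleGraph V) : Prop :=
  ∀ x y z w, H.Adj x y → H.Adj x z → H.Adj x w → y = z ∨ y = w ∨ z = w

theorem isAcyclic_of_low {H : SimpleGraph V} (h : ∀ x, Low H x) : H.IsAcyclic := by
  intro u p hp
  obtain ⟨x, y, hxy, hs⟩ :=
    Set.ncard_eq_two.1 (hp.ncard_neighborSet_toSubgraph_eq_two p.start_mem_support)
  have hadj : ∀ z, z ∈ p.toSubgraph.neighborSet u → H.Adj u z := fun z hz =>
    Subgraph.Adj.adj_sub (show p.toSubgraph.Adj u z from hz)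
  exact hxy (h u x y (hadj x (by simp [hs])) (hadj y (by simp [hs])))

/-- A finite forest of maximum degree at most two is a linear forest. -/
theorem isLinearForest_of_degLeTwo [Finite V] {H : SimpleGraph V} (hac : H.IsAcyclic)
    (hdeg : DegLeTwo H) : IsLinearForest H := by
  classical
  have := Fintype.ofFinite V
  refine ⟨hac, fun c => ?_⟩
  obtain ⟨r, hr⟩ := c.exists_rep
  -- a longest path in the component
  let L : Set ℕ := {k | ∃ (u v : V) (p : H.Walk u v), p.IsPath ∧ H.Reachable r u ∧ p.length = k}
  have hLne : L.Nonempty := ⟨0, r, r, .nil, by simp, .refl r, rfl⟩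
  have hLbd : BddAbove L := by
    refine ⟨Fintype.card V, ?_⟩
    rintro k ⟨u, v, p, hp, -, rfl⟩
    exact hp.length_lt.le
  obtain ⟨u, v, p, hp, hru, hlen⟩ := Nat.sSup_mem hLne hLbd
  have hmax : ∀ (u' v' : V) (q : H.Walk u' v'), q.IsPath → H.Reachable r u' → q.length ≤ p.length :=
    fun u' v' q hq hr' => hlen ▸ le_csSup hLbd ⟨u', v', q, hq, hr', rfl⟩
  -- the path is closed under adjacency, with all its edges
  have hstart : ∀ y, H.Adj u y → y ∈ p.support := by
    intro y hy
    by_contra hn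
    have := hmax y v (.cons hy.symm p) (hp.cons hn) (hru.trans hy.reachable)
    simp at this
  have hend : ∀ y, H.Adj v y → y ∈ p.support := by
    intro y hy
    by_contra hn
    have := hmax u y (p.concat hy) (hp.concat hn hy) hru
    simp at this
  have hclosed : ∀ x ∈ p.support, ∀ y, H.Adj x y → y ∈ p.support := by
    intro x hx y hy
    obtain ⟨i, hi, hil⟩ := Walk.mem_support_iff_exists_getVert.1 hx
    by_cases h0 : i = 0
    · subst h0; simp at hi; subst hi; exact hstart y hy
    by_cases h1 : i = p.length
    · subst h1; simp at hi; subst hi; exact hend y hy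
    -- An inner vertex already has two distinct neighbours on the path, so the degree bound leaves
    -- no room for a third.
    obtain ⟨j, rfl⟩ := Nat.exists_eq_succ_of_ne_zero h0
    have a1 : H.Adj x (p.getVert j) := by
      rw [← hi]; exact (p.adj_getVert_succ (by omega)).symm
    have a2 : H.Adj x (p.getVert (j + 2)) := by
      rw [← hi]; exact p.adj_getVert_succ (by omega)
    rcases hdeg x y _ _ hy a1 a2 with h | h | h
    · rw [h]; exact p.getVert_mem_support _
    · rw [h]; exact p.getVert_mem_support _
    · have := hp.getVert_injOn (by simp; omega) (by simp; omega) h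
      omega
  have hedge : ∀ x ∈ p.support, ∀ y, H.Adj x y → p.toSubgraph.Adj x y := by
    intro x hx y hy
    have hy' := hclosed x hx y hy
    rw [Walk.adj_toSubgraph_iff_mem_edges]
    -- In a forest every edge is a bridge, so it lies on each walk between its end vertices, in
    -- particular on one made of pieces of `p`. Hence `p` has no chords.
    have hb := isAcyclic_iff_forall_adj_isBridge.1 hac hy
    rw [isBridge_iff_forall_walk_mem_edges] at hb
    have hw := hb ((p.takeUntil x hx).reverse.append (p.takeUntil y hy'))
    rw [Walk.edges_append, List.mem_append, Walk.edges_reverse, List.mem_reverse] at hw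
    rcases hw with hw | hw
    · exact p.edges_takeUntil_subset_edges hx hw
    · exact p.edges_takeUntil_subset_edges hy' hw
  refine ⟨u, v, p, hp, ?_⟩
  have hsupp : ∀ x, x ∈ p.support ↔ x ∈ c.supp := by
    intro x
    have hc : x ∈ c.supp ↔ H.Reachable u x := by
      rw [ConnectedComponent.mem_supp_iff, ← hr]
      change H.connectedComponentMk x = H.connectedComponentMk r ↔ _
      rw [ConnectedComponent.eq]
      exact ⟨fun h => hru.symm.trans h.symm, fun h => h.symm.trans hru.symm⟩
    rw [hc]
    constructor
    · intro hx; exact (p.takeUntil x hx).reachable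
    · rintro ⟨q⟩
      have : ∀ {a b : V} (q : H.Walk a b), a ∈ p.support → b ∈ p.support := by
        intro a b q
        induction q with
        | nil => exact id
        | cons h _ ih => exact fun ha => ih (hclosed _ ha _ h)
      exact this q p.start_mem_support
  apply Subgraph.ext
  · ext x
    simp only [Walk.mem_verts_toSubgraph, Subgraph.induce_verts, hsupp]
  · ext x y
    simp only [Subgraph.induce_adj, Subgraph.top_adj]
    constructor
    · intro h
      refine ⟨(hsupp _).1 ?_, (hsupp _).1 ?_, h.adj_sub⟩
      · exact (Walk.mem_verts_toSubgraph p).1 h.fst_mem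
      · exact (Walk.mem_verts_toSubgraph p).1 h.snd_mem
    · rintro ⟨h1, -, h3⟩
      exact hedge x ((hsupp x).2 h1) y h3

/-! ### Linear forests with pointers between the ends of each path -/

/-- `H` is a linear forest and `fin` maps each end of a path to the other one. -/
structure PathEnds (H : SimpleGraph V) (fin : V → V) : Prop where
  acyclic : H.IsAcyclic
  deg : DegLeTwo H
  low : ∀ x, Low H x → Low H (fin x)
  invol : ∀ x, Low H x → fin (fin x) = x
  reach : ∀ x, Low H x → H.Reachable x (fin x)
  eq : ∀ x y, Low H x → Low H y → H.Reachable x y → y = x ∨ y = fin x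
  isolated : ∀ x, Low H x → fin x = x → ∀ y, ¬ H.Adj x y

theorem PathEnds.bot : PathEnds (⊥ : SimpleGraph V) id where
  acyclic := isAcyclic_bot
  deg := by intro x y z w h; simp at h
  low := fun _ h => h
  invol := fun _ _ => rfl
  reach := fun x _ => .refl x
  eq := by intro x y _ _ h; simp at h; exact .inl h.symm
  isolated := by simp

/-- A walk that crosses the new edge repeatedly can be shortened to one that crosses it at most
once. -/
theorem reachable_sup_edge_cases {H : SimpleGraph V} {u v x y : V}
    (h : (H ⊔ edge u v).Reachable x y) :
    H.Reachable x y ∨ (H.Reachable x u ∧ H.Reachable v y) ∨ (H.Reachable x v ∧ H.Reachable u y) := by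
  obtain ⟨p⟩ := h
  induction p with
  | nil => exact .inl (.refl _)
  | cons hadj _ ih =>
    rw [sup_adj, edge_adj] at hadj
    rcases hadj with h | ⟨⟨rfl, rfl⟩ | ⟨rfl, rfl⟩, -⟩
    · have := h.reachable
      rcases ih with ih | ih | ih
      · exact .inl (this.trans ih)
      · exact .inr (.inl ⟨this.trans ih.1, ih.2⟩)
      · exact .inr (.inr ⟨this.trans ih.1, ih.2⟩)
    · rcases ih with ih | ih | ih
      · exact .inr (.inl ⟨.refl _, ih⟩)
      · exact .inr (.inl ⟨.refl _, ih.2⟩)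
      · exact .inl ih.2
    · rcases ih with ih | ih | ih
      · exact .inr (.inr ⟨.refl _, ih⟩)
      · exact .inl ih.2
      · exact .inr (.inr ⟨.refl _, ih.2⟩)

theorem eq_of_reachable_of_isolated {H : SimpleGraph V} {x y : V} (h : H.Reachable x y)
    (hx : ∀ z, ¬ H.Adj x z) : y = x := by
  obtain ⟨p⟩ := h
  cases p with
  | nil => rfl
  | cons h _ => exact absurd h (hx _)

/-- Joining two distinct paths at ends `u` and `v`. -/
theorem PathEnds.join [DecidableEq V] {H : SimpleGraph V} {fin : V → V} (h : PathEnds H fin)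
    {u v : V} (huv : u ≠ v) (hu : Low H u) (hv : Low H v) (hne : fin u ≠ v) :
    PathEnds (H ⊔ edge u v)
      (Function.update (Function.update fin (fin u) (fin v)) (fin v) (fin u)) := by
  -- A path has no ends besides `u` and `fin u`, so `v` lies on another path and the new edge closes
  -- no cycle.
  have hnr : ¬ H.Reachable u v := fun hr => by
    rcases h.eq u v hu hv hr with h' | h'
    · exact huv h'.symm
    · exact hne h'.symm
  have hab : fin u ≠ fin v := fun hab =>
    hnr ((h.reach u hu).trans (hab ▸ (h.reach v hv).symm))
  have hle : H ≤ H ⊔ edge u v := le_sup_left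
  have hadj : (H ⊔ edge u v).Adj u v := by simp [edge_adj, huv]
  have hlow : ∀ x, Low (H ⊔ edge u v) x → Low H x := fun x hx y z hy hz => hx y z (hle hy) (hle hz)
  have isou : Low (H ⊔ edge u v) u → ∀ y, ¬ H.Adj u y := fun hl y hy =>
    hnr ((hl y v (hle hy) hadj) ▸ hy.reachable)
  have isov : Low (H ⊔ edge u v) v → ∀ y, ¬ H.Adj v y := fun hl y hy =>
    hnr ((hl y u (hle hy) hadj.symm) ▸ hy.reachable.symm)
  have finu : Low (H ⊔ edge u v) u → fin u = u := fun hl =>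
    eq_of_reachable_of_isolated (h.reach u hu) (isou hl)
  have finv : Low (H ⊔ edge u v) v → fin v = v := fun hl =>
    eq_of_reachable_of_isolated (h.reach v hv) (isov hl)
  have low_of_ne : ∀ x, Low H x → x ≠ u → x ≠ v → Low (H ⊔ edge u v) x := by
    intro x hx hxu hxv y z hy hz
    simp only [sup_adj, edge_adj, hxu, hxv, false_and, or_self, or_false] at hy hz
    exact hx y z hy hz
  -- If `u` is a one-vertex path, it has no old edge and remains an end after receiving the new one.
  have low_u : fin u = u → Low (H ⊔ edge u v) u := by
    intro hf y z hy hz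
    have := h.isolated u hu hf
    simp only [sup_adj, edge_adj, this, huv, false_and, true_and, or_false, false_or] at hy hz
    exact hy.1.trans hz.1.symm
  have low_v : fin v = v → Low (H ⊔ edge u v) v := by
    intro hf y z hy hz
    have := h.isolated v hv hf
    simp only [sup_adj, edge_adj, this, huv.symm, false_and, true_and, false_or] at hy hz
    exact hy.1.trans hz.1.symm
  have hau : fin u ≠ v := hne
  have hbu : fin v ≠ u := fun hb => hnr (hb ▸ (h.reach v hv)).symm
  have low_a : Low (H ⊔ edge u v) (fin u) := by
    by_cases hf : fin u = u
    · rw [hf]; exact low_u hf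
    · exact low_of_ne _ (h.low u hu) hf hau
  have low_b : Low (H ⊔ edge u v) (fin v) := by
    by_cases hf : fin v = v
    · rw [hf]; exact low_v hf
    · exact low_of_ne _ (h.low v hv) hbu hf
  set g := Function.update (Function.update fin (fin u) (fin v)) (fin v) (fin u) with hg
  have ga : g (fin u) = fin v := by simp [hg, hab]
  have gb : g (fin v) = fin u := by simp [hg]
  have gx : ∀ x, x ≠ fin u → x ≠ fin v → g x = fin x := fun x h1 h2 => by simp [hg, h1, h2]
  have ruv : (H ⊔ edge u v).Reachable (fin u) (fin v) :=
    ((h.reach u hu).symm.mono hle).trans (hadj.reachable.trans ((h.reach v hv).mono hle))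
  -- Of the path through `u`, only the end opposite to `u` is still an end after the join. The
  -- vertex `u` itself qualifies only if it was isolated, and then it is its own opposite end.
  have eq_a : ∀ x, Low (H ⊔ edge u v) x → H.Reachable x u → x = fin u := by
    intro x hx hr
    rcases h.eq u x hu (hlow x hx) hr.symm with h' | h'
    · subst h'; exact (finu hx).symm
    · exact h'
  have eq_b : ∀ x, Low (H ⊔ edge u v) x → H.Reachable x v → x = fin v := by
    intro x hx hr
    rcases h.eq v x hv (hlow x hx) hr.symm with h' | h'
    · subst h'; exact (finv hx).symm
    · exact h'
  refine ⟨h.acyclic.sup_edge_of_not_reachable hnr, ?_, ?_, ?_, ?_, ?_, ?_⟩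
  · intro x y z w hy hz hw
    by_cases hxu : x = u
    · subst hxu
      simp only [sup_adj, edge_adj, true_and, huv, false_and, or_false] at hy hz hw
      rcases hy with hy | hy <;> rcases hz with hz | hz <;> rcases hw with hw | hw
      all_goals first
        | exact .inl (hu _ _ hy hz)
        | exact .inr (.inl (hu _ _ hy hw))
        | exact .inr (.inr (hu _ _ hz hw))
        | exact .inl (hy.1.trans hz.1.symm)
        | exact .inr (.inl (hy.1.trans hw.1.symm))
        | exact .inr (.inr (hz.1.trans hw.1.symm))
    by_cases hxv : x = v
    · subst hxv
      simp only [sup_adj, edge_adj, true_and, huv.symm, false_and, false_or] at hy hz hw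
      rcases hy with hy | hy <;> rcases hz with hz | hz <;> rcases hw with hw | hw
      all_goals first
        | exact .inl (hv _ _ hy hz)
        | exact .inr (.inl (hv _ _ hy hw))
        | exact .inr (.inr (hv _ _ hz hw))
        | exact .inl (hy.1.trans hz.1.symm)
        | exact .inr (.inl (hy.1.trans hw.1.symm))
        | exact .inr (.inr (hz.1.trans hw.1.symm))
    simp only [sup_adj, edge_adj, hxu, hxv, false_and, or_self, or_false] at hy hz hw
    exact h.deg x y z w hy hz hw
  · intro x hx
    by_cases h1 : x = fin u
    · rw [h1, ga]; exact low_b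
    by_cases h2 : x = fin v
    · rw [h2, gb]; exact low_a
    rw [gx x h1 h2]
    refine low_of_ne _ (h.low x (hlow x hx)) (fun hf => h1 ?_) (fun hf => h2 ?_)
    · rw [← hf, h.invol x (hlow x hx)]
    · rw [← hf, h.invol x (hlow x hx)]
  · intro x hx
    by_cases h1 : x = fin u
    · rw [h1, ga, gb]
    by_cases h2 : x = fin v
    · rw [h2, gb, ga]
    have h3 := h.reach x (hlow x hx)
    rw [gx x h1 h2, gx, h.invol x (hlow x hx)]
    · exact fun hf => h1 (eq_a x hx (h3.trans (hf ▸ (h.reach u hu).symm)))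
    · exact fun hf => h2 (eq_b x hx (h3.trans (hf ▸ (h.reach v hv).symm)))
  · intro x hx
    by_cases h1 : x = fin u
    · rw [h1, ga]; exact ruv
    by_cases h2 : x = fin v
    · rw [h2, gb]; exact ruv.symm
    rw [gx x h1 h2]
    exact (h.reach x (hlow x hx)).mono hle
  · intro x y hx hy hr
    rcases reachable_sup_edge_cases hr with hr | hr | hr
    · rcases h.eq x y (hlow x hx) (hlow y hy) hr with h' | h'
      · exact .inl h'
      by_cases h1 : x = fin u
      · left
        rw [h1, ← eq_a y hy (hr.symm.trans (h1 ▸ (h.reach u hu).symm))]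
      by_cases h2 : x = fin v
      · left
        rw [h2, ← eq_b y hy (hr.symm.trans (h2 ▸ (h.reach v hv).symm))]
      rw [gx x h1 h2]; exact .inr h'
    · right
      rw [eq_a x hx hr.1, ga]; exact eq_b y hy hr.2.symm
    · right
      rw [eq_b x hx hr.1, gb]; exact eq_a y hy hr.2.symm
  · intro x hx hf y hy
    by_cases h1 : x = fin u
    · rw [h1, ga] at hf; exact hab hf.symm
    by_cases h2 : x = fin v
    · rw [h2, gb] at hf; exact hab hf
    rw [gx x h1 h2] at hf
    have hxu : x ≠ u := fun he => h1 (by rw [← he, hf])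
    have hxv : x ≠ v := fun he => h2 (by rw [← he, hf])
    simp only [sup_adj, edge_adj, hxu, hxv, false_and, or_self, or_false] at hy
    exact h.isolated x (hlow x hx) hf y hy

end GraphLemmas

/-! ### Linked adjacency lists -/

/-- The half-edges at a vertex `v` form a linked list that starts at `first v` and continues by
`nxt`; links are shifted by one, `0` being the end of a list. Half-edge `k` leads from `tail k` to
`head k` and belongs to edge `eid k`. -/
structure Lists where
  first : ℕ → ℕ
  nxt : ℕ → ℕ
  tail : ℕ → ℕ
  head : ℕ → ℕ
  eid : ℕ → ℕ

section Search

variable {n m : ℕ} {src dst : Fin m → Fin n} {lab : Fin m → ℕ} {i : ℕ}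

/-- Half-edge `k` is edge `e`, directed from `x` to `y`. -/
structure Lists.Half (src dst : Fin m → Fin n) (A : Lists) (k : ℕ) (e : Fin m) (x y : Fin n) :
    Prop where
  ends : s(src e, dst e) = s(x, y)
  eid : A.eid k = e
  tail : A.tail k = x
  head : A.head k = y

/-- The lists contain exactly the half-edges `0, …, K - 1`, each list in decreasing order. -/
structure Lists.Valid (src dst : Fin m → Fin n) (A : Lists) (K : ℕ) : Prop where
  half : ∀ k < K, ∃ e x y, A.Half src dst k e x y
  first_tail : ∀ v h, A.first v = h + 1 → h < K ∧ A.tail h = v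
  first_max : ∀ k < K, k < A.first (A.tail k)
  nxt_tail : ∀ k < K, ∀ h, A.nxt k = h + 1 → h < k ∧ A.tail h = A.tail k
  nxt_max : ∀ k < K, ∀ k' < k, A.tail k' = A.tail k → k' < A.nxt k

/-- Every edge occurs in both directions. -/
def Lists.Complete (src dst : Fin m → Fin n) (A : Lists) (K : ℕ) (e : Fin m) : Prop :=
  ∀ x y, s(src e, dst e) = s(x, y) → ∃ k < K, A.Half src dst k e x y

/-- Insert half-edge `K`. -/
def Lists.push (A : Lists) (K e x y : ℕ) : Lists where
  first := Function.update A.first x (K + 1)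
  nxt := Function.update A.nxt K (A.first x)
  tail := Function.update A.tail K x
  head := Function.update A.head K y
  eid := Function.update A.eid K e

theorem Lists.Half.push {A : Lists} {k K : ℕ} {e : Fin m} {x y : Fin n}
    (h : A.Half src dst k e x y) (hk : k < K) (e' x' y' : ℕ) :
    (A.push K e' x' y').Half src dst k e x y := by
  have : k ≠ K := hk.ne
  exact ⟨h.ends, by simp [Lists.push, this, h.eid], by simp [Lists.push, this, h.tail],
    by simp [Lists.push, this, h.head]⟩

theorem Lists.half_push (A : Lists) (K : ℕ) {e : Fin m} {x y : Fin n}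
    (h : s(src e, dst e) = s(x, y)) : (A.push K e x y).Half src dst K e x y :=
  ⟨h, by simp [Lists.push], by simp [Lists.push], by simp [Lists.push]⟩

/-- The new half-edge has the largest number, so putting it at the front of its list keeps the list
decreasing. -/
theorem Lists.Valid.push {A : Lists} {K : ℕ} (hA : A.Valid src dst K) {e : Fin m} {x y : Fin n}
    (h : s(src e, dst e) = s(x, y)) : (A.push K e x y).Valid src dst (K + 1) := by
  have tail_lt : ∀ k < K, (A.push K e x y).tail k = A.tail k := fun k hk => by
    simp [Lists.push, hk.ne]
  have tail_K : (A.push K e x y).tail K = x := by simp [Lists.push]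
  have nxt_lt : ∀ k < K, (A.push K e x y).nxt k = A.nxt k := fun k hk => by
    simp [Lists.push, hk.ne]
  have nxt_K : (A.push K e x y).nxt K = A.first x := by simp [Lists.push]
  have first_x : (A.push K e x y).first x = K + 1 := by simp [Lists.push]
  have first_ne : ∀ v : ℕ, v ≠ x → (A.push K e x y).first v = A.first v := fun v hv => by
    simp [Lists.push, hv]
  refine ⟨?_, ?_, ?_, ?_, ?_⟩
  · intro k hk
    rcases Nat.lt_succ_iff_lt_or_eq.1 hk with hk | rfl
    · obtain ⟨e', x', y', h'⟩ := hA.half k hk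
      exact ⟨e', x', y', h'.push hk _ _ _⟩
    · exact ⟨e, x, y, A.half_push k h⟩
  · intro v h hv
    by_cases hvx : v = x
    · subst hvx
      rw [first_x] at hv
      obtain rfl : K = h := by omega
      exact ⟨by omega, tail_K⟩
    · rw [first_ne v hvx] at hv
      obtain ⟨h1, h2⟩ := hA.first_tail v h hv
      exact ⟨by omega, by rw [tail_lt h h1, h2]⟩
  · intro k hk
    rcases Nat.lt_succ_iff_lt_or_eq.1 hk with hk | rfl
    · rw [tail_lt k hk]
      by_cases hx : A.tail k = x
      · rw [hx, first_x]; omega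
      · rw [first_ne _ hx]; exact hA.first_max k hk
    · rw [tail_K, first_x]; omega
  · intro k hk h hh
    rcases Nat.lt_succ_iff_lt_or_eq.1 hk with hk | rfl
    · rw [nxt_lt k hk] at hh
      obtain ⟨h1, h2⟩ := hA.nxt_tail k hk h hh
      exact ⟨h1, by rw [tail_lt k hk, tail_lt h (by omega), h2]⟩
    · rw [nxt_K] at hh
      obtain ⟨h1, h2⟩ := hA.first_tail _ h hh
      exact ⟨h1, by rw [tail_K, tail_lt h h1, h2]⟩
  · intro k hk k' hk' ht
    rcases Nat.lt_succ_iff_lt_or_eq.1 hk with hk | rfl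
    · rw [nxt_lt k hk]
      rw [tail_lt k hk, tail_lt k' (by omega)] at ht
      exact hA.nxt_max k hk k' hk' ht
    · rw [nxt_K]
      rw [tail_K, tail_lt k' hk'] at ht
      rw [← ht]; exact hA.first_max k' hk'

/-! ### Graph search -/

/-- The state of a graph search: position of each vertex in the queue (shifted by one, `0` for
vertices not found yet), edge to the parent (shifted by one, `0` for roots), marks of tree edges,
the queue; next candidate for a root, bounds of the queue, next half-edge to scan (shifted by one,
`0` if none) and the vertex being scanned. -/
@[ext] structure SearchState where
  ord : ℕ → ℕ
  par : ℕ → ℕ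
  tree : ℕ → ℕ
  queue : ℕ → ℕ
  r : ℕ
  qh : ℕ
  qt : ℕ
  h : ℕ
  cur : ℕ

/-- The edges with label `i`. -/
abbrev labGraph (src dst : Fin m → Fin n) (lab : Fin m → ℕ) (i : ℕ) : SimpleGraph (Fin n) :=
  edgeGraph src dst {e | lab e = i}

/-- The marked edges. -/
abbrev markGraph (src dst : Fin m → Fin n) (tree : ℕ → ℕ) : SimpleGraph (Fin n) :=
  edgeGraph src dst {e | tree e = 1}

/-- The invariant of the search in the edges with label `i`. -/
structure SearchInv (src dst : Fin m → Fin n) (lab : Fin m → ℕ) (i : ℕ) (A : Lists)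
    (σ : SearchState) : Prop where
  lab_eq : ∀ e : Fin m, σ.tree e = 1 → lab e = i
  ord_le : ∀ v : Fin n, σ.ord v ≤ σ.qt
  queue_ord : ∀ v : Fin n, σ.ord v ≠ 0 → σ.queue (σ.ord v - 1) = v
  queue_vert : ∀ j < σ.qt, ∃ v : Fin n, σ.queue j = v ∧ σ.ord v = j + 1
  qh_le : σ.qh ≤ σ.qt
  next : ∀ k, σ.h = k + 1 → k < 2 * m ∧ A.tail k = σ.cur
  cur : σ.h ≠ 0 → ∃ c : Fin n, σ.cur = c ∧ σ.ord c ≠ 0 ∧ σ.ord c ≤ σ.qh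
  roots : ∀ v : Fin n, (v : ℕ) < σ.r → σ.ord v ≠ 0
  span : ∀ x y : Fin n, σ.ord x ≠ 0 → σ.ord y ≠ 0 → (labGraph src dst lab i).Reachable x y →
    (markGraph src dst σ.tree).Reachable x y
  front : ∀ k < 2 * m, ∀ e x y, A.Half src dst k e x y → lab e = i → σ.ord x ≠ 0 →
    σ.ord y ≠ 0 ∨ σ.qh < σ.ord x ∨ ((x : ℕ) = σ.cur ∧ k < σ.h)
  root : ∀ v x : Fin n, σ.par v = 0 → σ.ord x ≠ 0 → σ.ord x < σ.ord v →
    ¬ (labGraph src dst lab i).Reachable x v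
  parent : ∀ (v : Fin n) e, σ.par v = e + 1 → ∃ (f : Fin m) (w : Fin n), e = f ∧ σ.tree f = 1 ∧
    s(src f, dst f) = s(v, w) ∧ σ.ord w ≠ 0 ∧ σ.ord w < σ.ord v
  top : ∀ e : Fin m, σ.tree e = 1 → ∃ v w : Fin n, s(src e, dst e) = s(v, w) ∧ σ.par v = e + 1 ∧
    σ.ord w ≠ 0 ∧ σ.ord w < σ.ord v

/-- An upper bound on the number of remaining steps of the search. -/
def SearchState.potential (n m : ℕ) (A : Lists) (σ : SearchState) : ℕ :=
  ((Finset.range n).filter fun v => σ.ord v = 0 ∨ σ.qh < σ.ord v).card +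
  ((Finset.range (2 * m)).filter fun k => σ.ord (A.tail k) = 0 ∨ σ.qh < σ.ord (A.tail k) ∨
    (A.tail k = σ.cur ∧ k < σ.h)).card + (n - σ.r)

/-- Append vertex `w` to the queue. -/
def SearchState.enqueue (σ : SearchState) (w : ℕ) : SearchState :=
  { σ with
    ord := Function.update σ.ord w (σ.qt + 1)
    queue := Function.update σ.queue σ.qt w
    qt := σ.qt + 1 }

def SearchState.addRoot (σ : SearchState) : SearchState :=
  { σ.enqueue σ.r with r := σ.r + 1 }

def SearchState.skipRoot (σ : SearchState) : SearchState := { σ with r := σ.r + 1 }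

def SearchState.dequeue (A : Lists) (σ : SearchState) : SearchState :=
  { σ with
    cur := σ.queue σ.qh
    h := A.first (σ.queue σ.qh)
    qh := σ.qh + 1 }

/-- Go on to the half-edge after `k`. -/
def SearchState.advance (A : Lists) (σ : SearchState) (k : ℕ) : SearchState :=
  { σ with h := A.nxt k }

/-- Mark the edge of half-edge `k` and enqueue its head. -/
def SearchState.grow (A : Lists) (σ : SearchState) (k : ℕ) : SearchState :=
  { σ.enqueue (A.head k) with
    par := Function.update σ.par (A.head k) (A.eid k + 1)
    tree := Function.update σ.tree (A.eid k) 1 }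

/-! ### Preservation of the search invariant -/

variable {A : Lists} {σ : SearchState}

/-- With the queue exhausted and no half-edge pending, `front` leaves only its first alternative.
The found vertices are then closed under adjacency, hence a union of components. -/
theorem SearchInv.closed (hσ : SearchInv src dst lab i A σ)
    (hc : ∀ e, A.Complete src dst (2 * m) e) (hh : σ.h = 0) (hq : ¬ σ.qh < σ.qt) {x y : Fin n}
    (hxy : (labGraph src dst lab i).Reachable x y) (hx : σ.ord x ≠ 0) : σ.ord y ≠ 0 := by
  obtain ⟨p⟩ := hxy
  induction p with
  | nil => exact hx
  | @cons a _ _ hadj _ ih =>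
    obtain ⟨-, e, he, hs⟩ := hadj
    obtain ⟨k, hk, hhalf⟩ := hc e _ _ hs
    have := hσ.ord_le a
    rcases hσ.front k hk e _ _ hhalf he hx with h | h | h
    · exact ih h
    · omega
    · omega

theorem SearchInv.skipRoot (hσ : SearchInv src dst lab i A σ)
    (hr : ∀ v : Fin n, (v : ℕ) = σ.r → σ.ord v ≠ 0) : SearchInv src dst lab i A σ.skipRoot where
  __ := hσ
  roots := by
    intro v hv
    change (v : ℕ) < σ.r + 1 at hv
    rcases Nat.lt_succ_iff_lt_or_eq.1 hv with hv | hv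
    · exact hσ.roots v hv
    · exact hr v hv

/-- By `SearchInv.closed` no found vertex lies in the component of the new root. This saves `span`,
and it makes the root the first vertex of its component, as `root` requires. -/
theorem SearchInv.addRoot (hσ : SearchInv src dst lab i A σ)
    (hc : ∀ e, A.Complete src dst (2 * m) e) (hh : σ.h = 0) (hq : ¬ σ.qh < σ.qt)
    {v : Fin n} (hv : (v : ℕ) = σ.r) (hv0 : σ.ord v = 0) :
    SearchInv src dst lab i A σ.addRoot := by
  have hclosed := fun {x y} => @SearchInv.closed n m src dst lab i A σ hσ hc hh hq x y
  have ord_v : σ.addRoot.ord v = σ.qt + 1 := by simp [SearchState.addRoot, SearchState.enqueue, hv]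
  have ord_ne : ∀ x : Fin n, x ≠ v → σ.addRoot.ord x = σ.ord x := fun x hx => by
    have : (x : ℕ) ≠ σ.r := fun h => hx (Fin.ext (h.trans hv.symm))
    simp [SearchState.addRoot, SearchState.enqueue, this]
  have ord_of_ne : ∀ x : Fin n, σ.ord x ≠ 0 → σ.addRoot.ord x = σ.ord x := fun x hx =>
    ord_ne x fun h => hx (h ▸ hv0)
  have queue_qt : σ.addRoot.queue σ.qt = v := by
    simp [SearchState.addRoot, SearchState.enqueue, hv]
  have queue_ne : ∀ j, j ≠ σ.qt → σ.addRoot.queue j = σ.queue j := fun j hj => by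
    simp [SearchState.addRoot, SearchState.enqueue, hj]
  have hnr : ∀ x : Fin n, σ.ord x ≠ 0 → ¬ (labGraph src dst lab i).Reachable x v :=
    fun x hx hr => hclosed hr hx hv0
  refine ⟨hσ.lab_eq, ?_, ?_, ?_, ?_, hσ.next, ?_, ?_, ?_, ?_, ?_, ?_, ?_⟩
  · intro x
    change _ ≤ σ.qt + 1
    by_cases hx : x = v
    · rw [hx, ord_v]
    · rw [ord_ne x hx]; exact (hσ.ord_le x).trans (by omega)
  · intro x hx
    by_cases hxv : x = v
    · subst hxv; rw [ord_v]; simpa using queue_qt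
    · rw [ord_ne x hxv] at hx ⊢
      have := hσ.ord_le x
      rw [queue_ne _ (by omega)]
      exact hσ.queue_ord x hx
  · intro j hj
    change j < σ.qt + 1 at hj
    rcases Nat.lt_succ_iff_lt_or_eq.1 hj with hj | rfl
    · obtain ⟨x, h1, h2⟩ := hσ.queue_vert j hj
      exact ⟨x, by rw [queue_ne j hj.ne, h1], by rw [ord_of_ne x (by omega), h2]⟩
    · exact ⟨v, queue_qt, ord_v⟩
  · exact hσ.qh_le.trans (Nat.le_succ _)
  · intro h; exact absurd hh h
  · intro x hx
    by_cases hxv : x = v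
    · rw [hxv, ord_v]; omega
    · rw [ord_ne x hxv]
      change (x : ℕ) < σ.r + 1 at hx
      have : (x : ℕ) ≠ σ.r := fun h => hxv (Fin.ext (h.trans hv.symm))
      exact hσ.roots x (by omega)
  · intro x y hx hy hr
    by_cases hxv : x = v <;> by_cases hyv : y = v
    · rw [hxv, hyv]
    · rw [ord_ne y hyv] at hy
      exact absurd (hxv ▸ hr.symm) (hnr y hy)
    · rw [ord_ne x hxv] at hx
      exact absurd (hyv ▸ hr) (hnr x hx)
    · rw [ord_ne x hxv] at hx
      rw [ord_ne y hyv] at hy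
      exact hσ.span x y hx hy hr
  · intro k hk e x y hhalf he hx
    by_cases hxv : x = v
    · have := hσ.qh_le
      right; left; rw [hxv, ord_v]; exact Nat.lt_succ_of_le this
    · rw [ord_ne x hxv] at hx ⊢
      rcases hσ.front k hk e x y hhalf he hx with h | h | h
      · left; rw [ord_of_ne y h]; exact h
      · exact .inr (.inl h)
      · exact .inr (.inr h)
  · intro x y hp hy hlt
    by_cases hyv : y = v
    · have : σ.addRoot.ord x ≤ σ.qt + 1 := by
        by_cases hx : x = v
        · rw [hx, ord_v]
        · rw [ord_ne x hx]; exact (hσ.ord_le x).trans (by omega)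
      rw [hyv, ord_v] at hlt; omega
    · rw [ord_ne y hyv] at hy hlt
      by_cases hxv : x = v
      · rw [hxv]; exact hnr y hy
      · rw [ord_ne x hxv] at hlt
        exact hσ.root x y hp hy hlt
  · intro x e hp
    obtain ⟨f, w, h1, h2, h3, h4, h5⟩ := hσ.parent x e hp
    exact ⟨f, w, h1, h2, h3, by rw [ord_of_ne w h4]; exact h4,
      by rw [ord_of_ne w h4, ord_of_ne x (by omega)]; exact h5⟩
  · intro e he
    obtain ⟨x, w, h1, h2, h3, h4⟩ := hσ.top e he
    exact ⟨x, w, h1, h2, by rw [ord_of_ne w h3]; exact h3,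
      by rw [ord_of_ne w h3, ord_of_ne x (by omega)]; exact h4⟩

theorem SearchInv.dequeue (hσ : SearchInv src dst lab i A σ) (hA : A.Valid src dst (2 * m))
    (hh : σ.h = 0) (hq : σ.qh < σ.qt) : SearchInv src dst lab i A (σ.dequeue A) := by
  obtain ⟨v, hv, hord⟩ := hσ.queue_vert _ hq
  refine { hσ with qh_le := hq, next := ?_, cur := ?_, front := ?_ }
  · intro k hk
    exact hA.first_tail _ _ hk
  · intro _
    exact ⟨v, hv, by change σ.ord v ≠ 0; omega, by change σ.ord v ≤ σ.qh + 1; omega⟩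
  · intro k hk e x y hhalf he hx
    rcases hσ.front k hk e x y hhalf he hx with h | h | h
    · exact .inl h
    · right
      -- Positions are shifted by one, so this vertex is the one just taken from the queue. All its
      -- half-edges are pending, because the head of its list bounds their numbers.
      by_cases hx' : σ.ord x = σ.qh + 1
      · right
        have hxq := hσ.queue_ord x hx
        rw [hx', Nat.add_sub_cancel] at hxq
        refine ⟨hxq.symm, ?_⟩
        have := hA.first_max k hk
        rw [hhalf.tail, ← hxq] at this
        exact this
      · left; change σ.qh + 1 < σ.ord x; omega
    · omega

/-- Lists are decreasing, so the half-edges pending at `cur` are those below `σ.h`. Passing from `k`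
to its successor drops only `k` from them, and `hy` says that `k` is settled. -/
theorem SearchInv.advance (hσ : SearchInv src dst lab i A σ) (hA : A.Valid src dst (2 * m))
    {k : ℕ} (hk : σ.h = k + 1) {e : Fin m} {x y : Fin n} (hhalf : A.Half src dst k e x y)
    (hy : lab e = i → σ.ord y ≠ 0) : SearchInv src dst lab i A (σ.advance A k) := by
  obtain ⟨hk2, ht⟩ := hσ.next k hk
  refine { hσ with next := ?_, cur := ?_, front := ?_ }
  · intro k' hk'
    obtain ⟨h1, h2⟩ := hA.nxt_tail k hk2 k' hk'
    exact ⟨by omega, h2.trans ht⟩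
  · intro _
    exact hσ.cur (by omega)
  · intro k' hk' e' x' y' hhalf' he' hx'
    rcases hσ.front k' hk' e' x' y' hhalf' he' hx' with h | h | ⟨h, h'⟩
    · exact .inl h
    · exact .inr (.inl h)
    · rcases Nat.lt_succ_iff_lt_or_eq.1 (hk ▸ h') with h' | rfl
      · exact .inr (.inr ⟨h, hA.nxt_max k hk2 k' h' (by rw [hhalf'.tail, ht, h])⟩)
      · left
        obtain rfl : e' = e := Fin.ext (hhalf'.eid.symm.trans hhalf.eid)
        obtain rfl : y' = y := Fin.ext (hhalf'.head.symm.trans hhalf.head)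
        exact hy he'

/-- The new vertex gets the largest position so far and hangs on the vertex being scanned. Thus
parents precede children, and connections in the spanning forest pass through the parent. The
half-edge stays pending until the following `advance`, which needs the second conclusion. -/
theorem SearchInv.grow (hne : ∀ e, src e ≠ dst e) (hσ : SearchInv src dst lab i A σ)
    {k : ℕ} (hk : σ.h = k + 1) {e : Fin m} {x y : Fin n} (hhalf : A.Half src dst k e x y)
    (he : lab e = i) (hy0 : σ.ord y = 0) :
    SearchInv src dst lab i A (σ.grow A k) ∧ (σ.grow A k).ord y ≠ 0 := by
  obtain ⟨hk2, ht⟩ := hσ.next k hk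
  obtain ⟨c, hc, hc0, hcq⟩ := hσ.cur (by omega)
  obtain rfl : c = x := Fin.ext (by rw [← hc, ← ht, hhalf.tail])
  have ord_y : (σ.grow A k).ord y = σ.qt + 1 := by
    simp [SearchState.grow, SearchState.enqueue, hhalf.head]
  have ord_ne : ∀ z : Fin n, z ≠ y → (σ.grow A k).ord z = σ.ord z := fun z hz => by
    simp [SearchState.grow, SearchState.enqueue, hhalf.head, Fin.val_inj, hz]
  have ord_of_ne : ∀ z : Fin n, σ.ord z ≠ 0 → (σ.grow A k).ord z = σ.ord z := fun z hz =>
    ord_ne z fun h => hz (h ▸ hy0)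
  have par_y : (σ.grow A k).par y = e + 1 := by simp [SearchState.grow, hhalf.head, hhalf.eid]
  have par_ne : ∀ z : Fin n, z ≠ y → (σ.grow A k).par z = σ.par z := fun z hz => by
    simp [SearchState.grow, hhalf.head, Fin.val_inj, hz]
  have tree_e : (σ.grow A k).tree e = 1 := by simp [SearchState.grow, hhalf.eid]
  have tree_ne : ∀ f : Fin m, f ≠ e → (σ.grow A k).tree f = σ.tree f := fun f hf => by
    simp [SearchState.grow, hhalf.eid, Fin.val_inj, hf]
  have tree_of : ∀ f : Fin m, σ.tree f = 1 → (σ.grow A k).tree f = 1 := fun f hf => by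
    by_cases h : f = e
    · rw [h, tree_e]
    · rw [tree_ne f h, hf]
  have queue_qt : (σ.grow A k).queue σ.qt = y := by
    simp [SearchState.grow, SearchState.enqueue, hhalf.head]
  have queue_ne : ∀ j, j ≠ σ.qt → (σ.grow A k).queue j = σ.queue j := fun j hj => by
    simp [SearchState.grow, SearchState.enqueue, hj]
  have hmono : markGraph src dst σ.tree ≤ markGraph src dst (σ.grow A k).tree :=
    edgeGraph_mono fun f hf => tree_of f hf
  have hyx : (markGraph src dst (σ.grow A k).tree).Reachable c y :=
    (edgeGraph_adj_of_mem hne (show e ∈ {f : Fin m | (σ.grow A k).tree f = 1} from tree_e)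
      hhalf.ends).reachable
  have hyx' : (labGraph src dst lab i).Reachable c y :=
    (edgeGraph_adj_of_mem hne (show e ∈ {f : Fin m | lab f = i} from he) hhalf.ends).reachable
  refine ⟨?_, by omega⟩
  refine ⟨?_, ?_, ?_, ?_, ?_, hσ.next, ?_, ?_, ?_, ?_, ?_, ?_, ?_⟩
  · intro f hf
    by_cases h : f = e
    · rw [h, he]
    · rw [tree_ne f h] at hf; exact hσ.lab_eq f hf
  · intro z
    change _ ≤ σ.qt + 1
    by_cases hz : z = y
    · rw [hz, ord_y]
    · rw [ord_ne z hz]; exact (hσ.ord_le z).trans (by omega)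
  · intro z hz
    by_cases hzy : z = y
    · subst hzy; rw [ord_y]; simpa using queue_qt
    · rw [ord_ne z hzy] at hz ⊢
      have := hσ.ord_le z
      rw [queue_ne _ (by omega)]
      exact hσ.queue_ord z hz
  · intro j hj
    change j < σ.qt + 1 at hj
    rcases Nat.lt_succ_iff_lt_or_eq.1 hj with hj | rfl
    · obtain ⟨z, h1, h2⟩ := hσ.queue_vert j hj
      exact ⟨z, by rw [queue_ne j hj.ne, h1], by rw [ord_of_ne z (by omega), h2]⟩
    · exact ⟨y, queue_qt, ord_y⟩
  · exact hσ.qh_le.trans (Nat.le_succ _)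
  · intro _
    exact ⟨c, hc, by rw [ord_of_ne c hc0]; exact hc0, by rw [ord_of_ne c hc0]; exact hcq⟩
  · intro z hz
    have := hσ.roots z hz
    rw [ord_of_ne z this]; exact this
  · intro a b ha hb hr
    by_cases hay : a = y <;> by_cases hby : b = y
    · rw [hay, hby]
    · rw [ord_ne b hby] at hb
      subst hay
      exact hyx.symm.trans ((hσ.span c b hc0 hb (hyx'.trans hr)).mono hmono)
    · rw [ord_ne a hay] at ha
      subst hby
      exact ((hσ.span a c ha hc0 (hr.trans hyx'.symm)).mono hmono).trans hyx
    · rw [ord_ne a hay] at ha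
      rw [ord_ne b hby] at hb
      exact (hσ.span a b ha hb hr).mono hmono
  · intro k' hk' f a b hhalf' hf ha
    by_cases hay : a = y
    · have := hσ.qh_le
      right; left; rw [hay, ord_y]; exact Nat.lt_succ_of_le this
    · rw [ord_ne a hay] at ha ⊢
      rcases hσ.front k' hk' f a b hhalf' hf ha with h | h | h
      · left; rw [ord_of_ne b h]; exact h
      · exact .inr (.inl h)
      · exact .inr (.inr h)
  · intro a b hp hb hlt
    by_cases hay : a = y
    · rw [hay, par_y] at hp; omega
    rw [par_ne a hay] at hp
    rw [ord_ne a hay] at hlt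
    by_cases hby : b = y
    · have := hσ.ord_le a
      rw [hby, ord_y] at hlt; omega
    rw [ord_ne b hby] at hb hlt
    exact hσ.root a b hp hb hlt
  · intro a f hp
    by_cases hay : a = y
    · rw [hay, par_y] at hp
      have := hσ.ord_le c
      refine ⟨e, c, by omega, tree_e, by rw [hay, hhalf.ends, Sym2.eq_swap], ?_, ?_⟩
      · rw [ord_of_ne c hc0]; exact hc0
      · rw [ord_of_ne c hc0, hay, ord_y]; omega
    · rw [par_ne a hay] at hp
      obtain ⟨f', w, h1, h2, h3, h4, h5⟩ := hσ.parent a f hp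
      exact ⟨f', w, h1, tree_of f' h2, h3, by rw [ord_of_ne w h4]; exact h4,
        by rw [ord_of_ne w h4, ord_ne a hay]; exact h5⟩
  · intro f hf
    by_cases h : f = e
    · have := hσ.ord_le c
      refine ⟨y, c, by rw [h, hhalf.ends, Sym2.eq_swap], by rw [h, par_y], ?_, ?_⟩
      · rw [ord_of_ne c hc0]; exact hc0
      · rw [ord_of_ne c hc0, ord_y]; omega
    · rw [tree_ne f h] at hf
      obtain ⟨a, w, h1, h2, h3, h4⟩ := hσ.top f hf
      have ha : σ.ord a ≠ 0 := by omega
      exact ⟨a, w, h1, by rw [par_ne a fun h => ha (h ▸ hy0)]; exact h2,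
        by rw [ord_of_ne w h3]; exact h3, by rw [ord_of_ne w h3, ord_of_ne a ha]; exact h4⟩

/-! The potential decreases. -/

theorem SearchState.potential_skipRoot (hr : σ.r < n) :
    σ.skipRoot.potential n m A < σ.potential n m A := by
  refine Nat.add_lt_add_left ?_ _
  change n - (σ.r + 1) < n - σ.r
  omega

theorem card_filter_le_of_imp {s : Finset ℕ} {p q : ℕ → Prop} [DecidablePred p] [DecidablePred q]
    (h : ∀ x ∈ s, p x → q x) : (s.filter p).card ≤ (s.filter q).card :=
  Finset.card_le_card fun x hx => by
    rw [Finset.mem_filter] at hx ⊢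
    exact ⟨hx.1, h x hx.1 hx.2⟩

theorem card_filter_lt_of_imp {s : Finset ℕ} {p q : ℕ → Prop} [DecidablePred p] [DecidablePred q]
    (h : ∀ x ∈ s, p x → q x) {a : ℕ} (ha : a ∈ s) (hq : q a) (hp : ¬ p a) :
    (s.filter p).card < (s.filter q).card :=
  Finset.card_lt_card ((Finset.ssubset_iff_of_subset fun x hx => by
    rw [Finset.mem_filter] at hx ⊢
    exact ⟨hx.1, h x hx.1 hx.2⟩).2 ⟨a, by simp [ha, hq], by simp [hp]⟩)

/-- Vertices not found yet are already counted together with their half-edges, so finding one costs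
no potential. -/
theorem SearchState.potential_enqueue_le {w : ℕ} (hw : σ.ord w = 0) :
    (σ.enqueue w).potential n m A ≤ σ.potential n m A := by
  have key : ∀ v, (σ.enqueue w).ord v = 0 ∨ σ.qh < (σ.enqueue w).ord v →
      σ.ord v = 0 ∨ σ.qh < σ.ord v := by
    intro v hv
    by_cases h : v = w
    · exact .inl (h ▸ hw)
    · simpa [SearchState.enqueue, h] using hv
  refine Nat.add_le_add_right (Nat.add_le_add ?_ ?_) _
  · exact card_filter_le_of_imp fun v _ => key v
  · refine card_filter_le_of_imp fun k _ hk => ?_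
    rcases hk with h | h | h
    · rcases key _ (.inl h) with h | h
      · exact .inl h
      · exact .inr (.inl h)
    · rcases key _ (.inr h) with h | h
      · exact .inl h
      · exact .inr (.inl h)
    · exact .inr (.inr h)

theorem SearchState.potential_addRoot (hr : σ.r < n) (hw : σ.ord σ.r = 0) :
    σ.addRoot.potential n m A < σ.potential n m A :=
  (SearchState.potential_skipRoot (σ := σ.enqueue σ.r) (A := A) (m := m) hr).trans_le
    (SearchState.potential_enqueue_le hw)

theorem SearchState.potential_grow_le {k : ℕ} (hw : σ.ord (A.head k) = 0) :
    (σ.grow A k).potential n m A ≤ σ.potential n m A :=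
  SearchState.potential_enqueue_le hw

/-- The dequeued vertex leaves the first count. Its half-edges were counted before because of its
position, so the second count does not grow. -/
theorem SearchInv.potential_dequeue (hσ : SearchInv src dst lab i A σ) (hq : σ.qh < σ.qt) :
    (σ.dequeue A).potential n m A < σ.potential n m A := by
  obtain ⟨v, hv, hord⟩ := hσ.queue_vert _ hq
  refine Nat.add_lt_add_right (Nat.add_lt_add_of_lt_of_le ?_ ?_) _
  · refine card_filter_lt_of_imp (a := v) (fun x _ hx => ?_) (by simp) (.inr (by omega)) ?_
    · rcases hx with hx | hx
      · exact .inl hx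
      · exact .inr (Nat.lt_of_succ_lt hx)
    · change ¬ (σ.ord v = 0 ∨ σ.qh + 1 < σ.ord v)
      omega
  · refine card_filter_le_of_imp fun k hk hk' => ?_
    change σ.ord (A.tail k) = 0 ∨ σ.qh + 1 < σ.ord (A.tail k) ∨
      (A.tail k = σ.queue σ.qh ∧ k < A.first (σ.queue σ.qh)) at hk'
    rcases hk' with h | h | h
    · exact .inl h
    · exact .inr (.inl (by omega))
    · right; left; rw [h.1, hv, hord]; omega

theorem SearchInv.potential_advance (hσ : SearchInv src dst lab i A σ)
    (hA : A.Valid src dst (2 * m)) {k : ℕ} (hk : σ.h = k + 1) :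
    (σ.advance A k).potential n m A < σ.potential n m A := by
  obtain ⟨hk2, ht⟩ := hσ.next k hk
  obtain ⟨c, hc, hc0, hcq⟩ := hσ.cur (by omega)
  have hle : A.nxt k ≤ k := by
    rcases h : A.nxt k with _ | h'
    · omega
    · exact (hA.nxt_tail k hk2 h' h).1
  refine Nat.add_lt_add_right (Nat.add_lt_add_of_le_of_lt le_rfl ?_) _
  refine card_filter_lt_of_imp (a := k) (fun x _ hx => ?_) (by simpa using hk2) ?_ ?_
  · rcases hx with h | h | h
    · exact .inl h
    · exact .inr (.inl h)
    · have : x < A.nxt k := h.2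
      exact .inr (.inr ⟨h.1, by omega⟩)
  · exact .inr (.inr ⟨ht, by omega⟩)
  -- The half-edge `k` itself drops out: its tail is found and dequeued, and its successor link is
  -- at most `k`.
  · change ¬ (σ.ord (A.tail k) = 0 ∨ σ.qh < σ.ord (A.tail k) ∨ (A.tail k = σ.cur ∧ k < A.nxt k))
    rw [ht, hc]
    omega

/-- What a finished search has found out. -/
structure SearchResult (src dst : Fin m → Fin n) (lab : Fin m → ℕ) (i : ℕ)
    (ord par tree : ℕ → ℕ) : Prop where
  lab_eq : ∀ e : Fin m, tree e = 1 → lab e = i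
  ord_inj : ∀ x y : Fin n, ord x = ord y → x = y
  span : ∀ x y : Fin n, (labGraph src dst lab i).Reachable x y → (markGraph src dst tree).Reachable x y
  parent : ∀ v x : Fin n, (labGraph src dst lab i).Reachable x v → ord x < ord v →
    ∃ (f : Fin m) (w : Fin n), par v = f + 1 ∧ tree f = 1 ∧ s(src f, dst f) = s(v, w) ∧
      ord w < ord v
  top : ∀ e : Fin m, tree e = 1 → ∃ v w : Fin n, s(src e, dst e) = s(v, w) ∧ par v = e + 1 ∧
    ord w < ord v

/-- Once all vertices have been tried as roots, every vertex is found. Positions are then distinct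
because the queue recovers a vertex from its position. -/
theorem SearchInv.result (hσ : SearchInv src dst lab i A σ) (hr : n ≤ σ.r) :
    SearchResult src dst lab i σ.ord σ.par σ.tree := by
  have h0 : ∀ v : Fin n, σ.ord v ≠ 0 := fun v => hσ.roots v (v.2.trans_le hr)
  refine ⟨hσ.lab_eq, ?_, fun x y => hσ.span x y (h0 x) (h0 y), ?_, ?_⟩
  · intro x y h
    have hx := hσ.queue_ord x (h0 x)
    rw [h, hσ.queue_ord y (h0 y)] at hx
    exact Fin.ext hx.symm
  · intro v x hr hlt
    rcases hp : σ.par v with _ | e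
    · exact absurd hr (hσ.root v x hp (h0 x) hlt)
    · obtain ⟨f, w, h1, h2, h3, -, h5⟩ := hσ.parent v e hp
      exact ⟨f, w, by rw [h1], h2, h3, h5⟩
  · intro e he
    obtain ⟨v, w, h1, h2, -, h4⟩ := hσ.top e he
    exact ⟨v, w, h1, h2, h4⟩

end Search

/-! ### Building the adjacency lists -/

/-- Register `r` is increased by one. -/
def incr (r : ℕ) : Prog := .assign r (.succ (.reg r))

/-- Insert the half-edge of edge `reg 2` whose tail and head are in arrays `a` and `b`. -/
def pushHalf (a b : ℕ) : Prog :=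
  .seq (.write 5 (.reg 3) (.read 4 (.read a (.reg 2)))) <|
  .seq (.write 4 (.read a (.reg 2)) (.succ (.reg 3))) <|
  .seq (.write 6 (.reg 3) (.read a (.reg 2))) <|
  .seq (.write 7 (.reg 3) (.read b (.reg 2))) <|
  .seq (.write 8 (.reg 3) (.reg 2)) <|
  incr 3

def buildBody : Prog :=
  .seq (.write 3 (.reg 2) (.read 2 (.reg 2))) <|
  .seq (pushHalf 0 1) <|
  .seq (pushHalf 1 0) <|
  incr 2

/-- Build the adjacency lists in arrays `4`, …, `8`, and copy the labels to the output. -/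
def build : Prog := .loop (.lt (.reg 2) (.reg 1)) buildBody

def initEndsBody : Prog := .seq (.write 40 (.reg 2) (.reg 2)) (incr 2)

/-- Let the entries of array `40` point to themselves. -/
def initEnds : Prog :=
  .seq (.assign 2 (.const 0)) <|
  .loop (.lt (.reg 2) (.reg 0)) <|
  initEndsBody

/-- The adjacency lists in a store. -/
def Store.lists (s : Store) : Lists := ⟨s.arr 4, s.arr 5, s.arr 6, s.arr 7, s.arr 8⟩

/-- The input arrays are in place. -/
structure HasInput {n m : ℕ} (src dst : Fin m → Fin n) (lab : Fin m → ℕ) (s : Store) : Prop where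
  n_eq : s.reg 0 = n
  m_eq : s.reg 1 = m
  src_eq : ∀ e : Fin m, s.arr 0 e = src e
  dst_eq : ∀ e : Fin m, s.arr 1 e = dst e
  lab_eq : ∀ e : Fin m, s.arr 2 e = lab e

theorem hasInput_inputStore {n m : ℕ} (src dst : Fin m → Fin n) (lab : Fin m → ℕ) :
    HasInput src dst lab (inputStore src dst lab) := by
  constructor <;> simp [inputStore, toArr]

theorem HasInput.frame {n m : ℕ} {src dst : Fin m → Fin n} {lab : Fin m → ℕ} {s s' : Store}
    {p : Prog} (h : HasInput src dst lab s) (hf : Frame p s s') (h0 : ¬ p.Writes 0)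
    (h1 : ¬ p.Writes 1) (h2 : ¬ p.Writes 2) (r0 : ¬ p.Assigns 0) (r1 : ¬ p.Assigns 1) :
    HasInput src dst lab s' := by
  constructor
  · rw [hf.reg 0 r0, h.n_eq]
  · rw [hf.reg 1 r1, h.m_eq]
  · rw [hf.arr 0 h0]; exact h.src_eq
  · rw [hf.arr 1 h1]; exact h.dst_eq
  · rw [hf.arr 2 h2]; exact h.lab_eq

section Programs

variable {n m : ℕ} {src dst : Fin m → Fin n} {lab : Fin m → ℕ}

theorem lists_pushHalf (a b : ℕ) (ha : a < 4) (hb : b < 4) (s : Store) :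
    ((pushHalf a b).run s).lists =
      s.lists.push (s.reg 3) (s.reg 2) (s.arr a (s.reg 2)) (s.arr b (s.reg 2)) := by
  have h1 : a ≠ 4 := by omega
  have h2 : a ≠ 5 := by omega
  have h4 : b ≠ 4 := by omega
  have h5 : b ≠ 5 := by omega
  have h6 : b ≠ 6 := by omega
  simp [pushHalf, incr, Prog.run, Expr.eval, Store.lists, Lists.push, h1, h2, h4, h5, h6]

theorem pushHalf_reg_three (a b : ℕ) (s : Store) : ((pushHalf a b).run s).reg 3 = s.reg 3 + 1 := by
  simp [pushHalf, incr, Prog.run, Expr.eval]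

theorem pushHalf_reg_two (a b : ℕ) (s : Store) : ((pushHalf a b).run s).reg 2 = s.reg 2 := by
  simp [pushHalf, incr, Prog.run, Expr.eval]

theorem pushHalf_arr (a b : ℕ) {c : ℕ} (hc : c < 4) (s : Store) :
    ((pushHalf a b).run s).arr c = s.arr c := by
  have h1 : c ≠ 4 := by omega
  have h2 : c ≠ 5 := by omega
  have h3 : c ≠ 6 := by omega
  have h4 : c ≠ 7 := by omega
  have h5 : c ≠ 8 := by omega
  simp [pushHalf, incr, Prog.run, Expr.eval, h1, h2, h3, h4, h5]

/-- The invariant of `build`. -/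
structure BuildInv (src dst : Fin m → Fin n) (lab : Fin m → ℕ) (s : Store) : Prop where
  le : s.reg 2 ≤ m
  count : s.reg 3 = 2 * s.reg 2
  valid : s.lists.Valid src dst (s.reg 3)
  complete : ∀ e : Fin m, (e : ℕ) < s.reg 2 → s.lists.Complete src dst (s.reg 3) e
  out : ∀ e : Fin m, (e : ℕ) < s.reg 2 → s.arr 3 e = lab e

theorem BuildInv.step {s : Store} (hin : HasInput src dst lab s) (h : BuildInv src dst lab s)
    (hlt : s.reg 2 < m) : BuildInv src dst lab (buildBody.run s) ∧
      (buildBody.run s).reg 2 = s.reg 2 + 1 := by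
  obtain ⟨e, he⟩ : ∃ e : Fin m, s.reg 2 = e := ⟨⟨_, hlt⟩, rfl⟩
  set s₁ := s.setArr 3 (s.reg 2) (s.arr 2 (s.reg 2)) with hs₁
  have hrun : buildBody.run s =
      ((pushHalf 1 0).run ((pushHalf 0 1).run s₁)).setReg 2 (s.reg 2 + 1) := by
    simp [buildBody, incr, Prog.run, Expr.eval, pushHalf_reg_two, hs₁]
  have hl : (buildBody.run s).lists =
      (s.lists.push (s.reg 3) e (src e) (dst e)).push (s.reg 3 + 1) e (dst e) (src e) := by
    rw [hrun]
    change ((pushHalf 1 0).run ((pushHalf 0 1).run s₁)).lists = _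
    rw [lists_pushHalf 1 0 (by omega) (by omega), lists_pushHalf 0 1 (by omega) (by omega),
      pushHalf_reg_three, pushHalf_reg_two, pushHalf_arr 0 1 (by omega),
      pushHalf_arr 0 1 (by omega)]
    have h0 : s₁.arr 0 = s.arr 0 := by simp [hs₁]
    have h1 : s₁.arr 1 = s.arr 1 := by simp [hs₁]
    have h2 : s₁.reg = s.reg := rfl
    have h3 : s₁.lists = s.lists := by simp [hs₁, Store.lists]
    rw [h0, h1, h2, h3, he, hin.src_eq, hin.dst_eq]
  have h3 : (buildBody.run s).reg 3 = s.reg 3 + 1 + 1 := by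
    rw [hrun]
    simp [pushHalf_reg_three, hs₁]
  have h2 : (buildBody.run s).reg 2 = s.reg 2 + 1 := by rw [hrun]; simp
  have hout : (buildBody.run s).arr 3 = Function.update (s.arr 3) (s.reg 2) (lab e) := by
    rw [hrun]
    simp [pushHalf_arr, hs₁]
    rw [he, hin.lab_eq]
  -- Each edge contributes two half-edges, one in each direction.
  refine ⟨⟨by omega, by rw [h3, h2, h.count]; ring, ?_, ?_, ?_⟩, h2⟩
  · rw [hl, h3]
    exact (h.valid.push rfl).push Sym2.eq_swap
  · intro f hf x y hxy
    rw [hl, h3]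
    rw [h2, he] at hf
    rcases Nat.lt_succ_iff_lt_or_eq.1 hf with hf | hf
    · obtain ⟨k, hk, hh⟩ := h.complete f (by omega) x y hxy
      exact ⟨k, by omega, (hh.push (by omega) _ _ _).push (by omega) _ _ _⟩
    · obtain rfl : f = e := Fin.ext hf
      have hcases := hxy
      rw [Sym2.eq_iff] at hcases
      rcases hcases with ⟨rfl, rfl⟩ | ⟨rfl, rfl⟩
      · exact ⟨s.reg 3, by omega, (Lists.half_push _ _ hxy).push (by omega) _ _ _⟩
      · exact ⟨s.reg 3 + 1, by omega, Lists.half_push _ _ hxy⟩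
  · intro f hf
    rw [hout]
    rw [h2, he] at hf
    rcases Nat.lt_succ_iff_lt_or_eq.1 hf with hf | hf
    · rw [Function.update_of_ne (by omega)]
      exact h.out f (by omega)
    · obtain rfl : f = e := Fin.ext hf
      rw [he]; simp

theorem BuildInv.init : BuildInv src dst lab (inputStore src dst lab) := by
  refine ⟨by simp [inputStore], by simp [inputStore], ?_, ?_, ?_⟩
  · constructor <;> simp [inputStore, Store.lists]
  · intro e he; simp [inputStore] at he
  · intro e he; simp [inputStore] at he

theorem build_runs : ∃ C, ∀ (n m : ℕ) (src dst : Fin m → Fin n) (lab : Fin m → ℕ),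
    Runs build (inputStore src dst lab) (C * (n + m + 1)) fun s =>
      Frame build (inputStore src dst lab) s ∧ s.lists.Valid src dst (2 * m) ∧
      (∀ e, s.lists.Complete src dst (2 * m) e) ∧ ∀ e : Fin m, s.arr 3 e = lab e := by
  refine ⟨(Test.lt (.reg 2) (.reg 1)).cost + 1 + buildBody.bound, fun n m src dst lab => ?_⟩
  have key := Runs.loop (b := .lt (.reg 2) (.reg 1)) (p := buildBody) (K := buildBody.bound)
    (Inv := fun v s => v = m - s.reg 2 ∧ BuildInv src dst lab s) (s₀ := inputStore src dst lab)
    (v := m) ?_ ?_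
  · refine key.mono (Nat.mul_le_mul_left _ (by omega)) ?_
    rintro s ⟨hb, hf, v', -, hi⟩
    have hin : HasInput src dst lab s := (hasInput_inputStore src dst lab).frame hf
      (by simp [buildBody, pushHalf, incr, Prog.Writes])
      (by simp [buildBody, pushHalf, incr, Prog.Writes])
      (by simp [buildBody, pushHalf, incr, Prog.Writes])
      (by simp [buildBody, pushHalf, incr, Prog.Assigns])
      (by simp [buildBody, pushHalf, incr, Prog.Assigns])
    simp only [Test.Holds, Expr.eval, hin.m_eq] at hb
    have hm : s.reg 2 = m := le_antisymm hi.le (by omega)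
    refine ⟨hf.mono (fun _ => id) (fun _ => id), ?_, ?_, ?_⟩
    · have := hi.valid; rwa [hi.count, hm] at this
    · intro e
      have := hi.complete e (by omega)
      rwa [hi.count, hm] at this
    · exact fun e => hi.out e (by omega)
  · rintro v s hf ⟨rfl, hi⟩ hb
    have hin : HasInput src dst lab s := (hasInput_inputStore src dst lab).frame hf
      (by simp [buildBody, pushHalf, incr, Prog.Writes])
      (by simp [buildBody, pushHalf, incr, Prog.Writes])
      (by simp [buildBody, pushHalf, incr, Prog.Writes])
      (by simp [buildBody, pushHalf, incr, Prog.Assigns])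
      (by simp [buildBody, pushHalf, incr, Prog.Assigns])
    simp only [Test.Holds, Expr.eval, hin.m_eq] at hb
    obtain ⟨h1, h2⟩ := hi.step hin hb
    exact Prog.LoopFree.runs (by simp [buildBody, pushHalf, incr, Prog.LoopFree])
      ⟨_, by rw [h2]; omega, rfl, h1⟩
  · exact ⟨by simp [inputStore], .init⟩

/-- Absorbs the constant cost of an initialisation into the linear bound for the loop after it. -/
theorem init_add_loop_le {a b c v N : ℕ} (hN : 0 < N) (h : v + 1 ≤ c * N) :
    a + b * (v + 1) ≤ (a + b * c) * N := by
  rw [Nat.add_mul, mul_assoc]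
  exact Nat.add_le_add (Nat.le_mul_of_pos_right _ hN) (Nat.mul_le_mul_left _ h)

theorem initEnds_runs : ∃ C, ∀ (n m : ℕ) (s : Store), s.reg 0 = n →
    Runs initEnds s (C * (n + m + 1)) fun s' => Frame initEnds s s' ∧
      ∀ v < n, s'.arr 40 v = v := by
  refine ⟨(Prog.assign 2 (.const 0)).bound +
    ((Test.lt (.reg 2) (.reg 0)).cost + 1 + initEndsBody.bound) * 1, fun n m s hn => ?_⟩
  have key := Runs.loop (b := .lt (.reg 2) (.reg 0)) (p := initEndsBody) (K := initEndsBody.bound)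
    (Inv := fun v s => v = n - s.reg 2 ∧ s.reg 2 ≤ n ∧ ∀ v < s.reg 2, s.arr 40 v = v)
    (s₀ := s.setReg 2 0) (v := n) ?_ ?_
  · have := (Prog.LoopFree.runs (p := .assign 2 (.const 0)) (s := s) (Q := (· = s.setReg 2 0))
      trivial rfl).seq (q := .loop (.lt (.reg 2) (.reg 0)) initEndsBody) fun s' hs' => by
        subst hs'; exact key
    refine this.frame.mono ?_ ?_
    · exact init_add_loop_le (by omega) (by omega)
    · rintro s' ⟨⟨hb, hf, v', -, h2, h3⟩, hf'⟩
      refine ⟨hf', fun v hv => h3 v ?_⟩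
      have h0 : s'.reg 0 = n := by
        rw [hf.reg 0 (by simp [initEndsBody, incr, Prog.Assigns])]; simpa using hn
      simp only [Test.Holds, Expr.eval, h0] at hb
      omega
  · rintro v s' hf ⟨rfl, h2, h3⟩ hb
    have h0 : s'.reg 0 = n := by
      rw [hf.reg 0 (by simp [initEndsBody, incr, Prog.Assigns])]; simpa using hn
    simp only [Test.Holds, Expr.eval, h0] at hb
    have e2 : (initEndsBody.run s').reg 2 = s'.reg 2 + 1 := by simp [initEndsBody, incr, Prog.run, Expr.eval]
    have e40 : (initEndsBody.run s').arr 40 = Function.update (s'.arr 40) (s'.reg 2) (s'.reg 2) := by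
      simp [initEndsBody, incr, Prog.run, Expr.eval]
    refine Prog.LoopFree.runs (by simp [initEndsBody, incr, Prog.LoopFree])
      ⟨_, by rw [e2]; omega, rfl, by omega, fun v hv => ?_⟩
    rw [e40]
    by_cases h : v = s'.reg 2
    · simp [h]
    · rw [Function.update_of_ne h]
      exact h3 v (by omega)
  · exact ⟨by simp, by simp, by simp⟩

/-! ### The search program -/

/-- Append the vertex `w` to the queue. -/
def enqueueProg (i : ℕ) (w : Expr) : Prog :=
  .seq (.write (10 + i) w (.succ (.reg 6))) <|
  .seq (.write 9 (.reg 6) w) <|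
  incr 6

def dequeueProg : Prog :=
  .seq (.assign 8 (.read 9 (.reg 5))) <|
  .seq (.assign 7 (.read 4 (.reg 8))) <|
  incr 5

def rootProg (i : ℕ) : Prog :=
  .seq (.ite (.eq (.read (10 + i) (.reg 4)) (.const 0)) (enqueueProg i (.reg 4)) .skip) <|
  incr 4

def growProg (i : ℕ) : Prog :=
  .seq (enqueueProg i (.reg 9)) <|
  .seq (.write (20 + i) (.reg 9) (.succ (.reg 10))) <|
  .write (30 + i) (.reg 10) (.const 1)

def scanProg (i : ℕ) : Prog :=
  .seq (.assign 11 (.pred (.reg 7))) <|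
  .seq (.assign 10 (.read 8 (.reg 11))) <|
  .seq (.assign 9 (.read 7 (.reg 11))) <|
  .seq (.ite (.and (.eq (.read 2 (.reg 10)) (.const i)) (.eq (.read (10 + i) (.reg 9)) (.const 0)))
    (growProg i) .skip) <|
  .assign 7 (.read 5 (.reg 11))

def searchBody (i : ℕ) : Prog :=
  .ite (.eq (.reg 7) (.const 0)) (.ite (.lt (.reg 5) (.reg 6)) dequeueProg (rootProg i)) (scanProg i)

def searchTest : Test :=
  .not (.and (.eq (.reg 7) (.const 0))
    (.and (.not (.lt (.reg 5) (.reg 6))) (.not (.lt (.reg 4) (.reg 0)))))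

def searchInit : Prog :=
  .seq (.assign 4 (.const 0)) <|
  .seq (.assign 5 (.const 0)) <|
  .seq (.assign 6 (.const 0)) <|
  .assign 7 (.const 0)

/-- Search the graph of the edges with label `i`. The results are in arrays `10 + i` (positions in
the queue), `20 + i` (edges to parents) and `30 + i` (marks of tree edges). -/
def search (i : ℕ) : Prog := .seq searchInit (.loop searchTest (searchBody i))

/-- The state of the search in a store. -/
def Store.search (i : ℕ) (s : Store) : SearchState where
  ord := s.arr (10 + i)
  par := s.arr (20 + i)
  tree := s.arr (30 + i)
  queue := s.arr 9
  r := s.reg 4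
  qh := s.reg 5
  qt := s.reg 6
  h := s.reg 7
  cur := s.reg 8

theorem search_dequeueProg (i : ℕ) (s : Store) :
    (dequeueProg.run s).search i = (s.search i).dequeue s.lists := by
  ext <;> simp [dequeueProg, incr, Prog.run, Expr.eval, Store.search, SearchState.dequeue,
    Store.lists]

/-- This lets `simp` separate an array with fixed number from one whose number is shifted by a
symbolic `i`. -/
theorem eq_add_false {a b : ℕ} (i : ℕ) (h : a < b) : (a = b + i) = False :=
  eq_false (by omega)

theorem add_eq_false {a b : ℕ} (i : ℕ) (h : a < b) : (b + i = a) = False :=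
  eq_false (by omega)

theorem search_rootProg (i : ℕ) (s : Store) : ((rootProg i).run s).search i =
    if s.arr (10 + i) (s.reg 4) = 0 then (s.search i).addRoot else (s.search i).skipRoot := by
  by_cases h : s.arr (10 + i) (s.reg 4) = 0
  · ext <;> simp [rootProg, enqueueProg, incr, Prog.run, Expr.eval, Test.Holds, Store.search,
      SearchState.addRoot, SearchState.enqueue, h, eq_add_false, add_eq_false]
  · ext <;> simp [rootProg, enqueueProg, incr, Prog.run, Expr.eval, Test.Holds, Store.search,
      SearchState.skipRoot, h]

/-- One scan of the program is an optional `grow` followed by `advance` on abstract states, so the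
invariant and the potential need no mention of stores. The lists are shared by all labels, hence the
test of the label. -/
theorem search_scanProg (i : ℕ) (s : Store) {k : ℕ} (hk : s.reg 7 = k + 1) :
    ((scanProg i).run s).search i =
      if s.arr 2 (s.arr 8 k) = i ∧ s.arr (10 + i) (s.arr 7 k) = 0 then
        ((s.search i).grow s.lists k).advance s.lists k
      else (s.search i).advance s.lists k := by
  by_cases h : s.arr 2 (s.arr 8 k) = i ∧ s.arr (10 + i) (s.arr 7 k) = 0
  · obtain ⟨h1, h2⟩ := h
    ext <;> simp [scanProg, growProg, enqueueProg, incr, Prog.run, Expr.eval, Test.Holds,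
      Store.search, SearchState.grow, SearchState.enqueue, SearchState.advance, Store.lists, h1, h2,
      hk, eq_add_false, add_eq_false]
  · ext <;> simp [scanProg, growProg, enqueueProg, incr, Prog.run, Expr.eval, Test.Holds,
      Store.search, SearchState.advance, Store.lists, h, hk]

/-- The queue array may hold leftovers of an earlier search: the invariant constrains only its
entries below `qt`, which is reset to `0`. -/
theorem searchInv_init {i : ℕ} {s : Store} (ho : ∀ v, s.arr (10 + i) v = 0)
    (hp : ∀ v, s.arr (20 + i) v = 0) (ht : ∀ v, s.arr (30 + i) v = 0) (A : Lists) :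
    SearchInv src dst lab i A ((searchInit.run s).search i) := by
  constructor <;> simp [searchInit, Prog.run, Expr.eval, Store.search, ho, hp, ht]

theorem SearchInv.step {i : ℕ} {s : Store} {A : Lists} (hne : ∀ e, src e ≠ dst e)
    (hin : HasInput src dst lab s) (hA : A.Valid src dst (2 * m))
    (hc : ∀ e, A.Complete src dst (2 * m) e) (hl : s.lists = A)
    (hσ : SearchInv src dst lab i A (s.search i)) (hb : searchTest.Holds s) :
    SearchInv src dst lab i A (((searchBody i).run s).search i) ∧
      (((searchBody i).run s).search i).potential n m A < (s.search i).potential n m A := by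
  have hb' : ¬ (s.reg 7 = 0 ∧ ¬ s.reg 5 < s.reg 6 ∧ ¬ s.reg 4 < n) := by
    simpa [searchTest, Test.Holds, Expr.eval, hin.n_eq] using hb
  rcases hk : s.reg 7 with _ | k
  · have hh : (s.search i).h = 0 := hk
    by_cases hq : s.reg 5 < s.reg 6
    · have hrun : (searchBody i).run s = dequeueProg.run s := by
        simp [searchBody, Prog.run, Test.Holds, Expr.eval, hk, hq]
      rw [hrun, search_dequeueProg, hl]
      exact ⟨hσ.dequeue hA hh hq, hσ.potential_dequeue hq⟩
    · have hr : s.reg 4 < n := by tauto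
      have hrun : (searchBody i).run s = (rootProg i).run s := by
        simp [searchBody, Prog.run, Test.Holds, Expr.eval, hk, hq]
      rw [hrun, search_rootProg]
      split_ifs with h0
      · exact ⟨hσ.addRoot hc hh hq (v := ⟨s.reg 4, hr⟩) rfl h0,
          SearchState.potential_addRoot hr h0⟩
      · refine ⟨hσ.skipRoot ?_, SearchState.potential_skipRoot hr⟩
        intro v hv
        change (v : ℕ) = s.reg 4 at hv
        rw [hv]; exact h0
  · have hh : (s.search i).h = k + 1 := hk
    have hrun : (searchBody i).run s = (scanProg i).run s := by
      simp [searchBody, Prog.run, Test.Holds, Expr.eval, hk]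
    obtain ⟨hk2, -⟩ := hσ.next k hh
    obtain ⟨e, x, y, hhalf⟩ := hA.half k hk2
    have he : s.arr 8 k = e := by rw [← hhalf.eid, ← hl]; rfl
    have hy : s.arr 7 k = y := by rw [← hhalf.head, ← hl]; rfl
    rw [hrun, search_scanProg i s hk, he, hy, hin.lab_eq, hl]
    split_ifs with h0
    · obtain ⟨h1, h2⟩ := hσ.grow hne hh hhalf h0.1 h0.2
      refine ⟨h1.advance hA hh hhalf fun _ => h2, (h1.potential_advance hA hh).trans_le ?_⟩
      exact SearchState.potential_grow_le (by rw [hhalf.head]; exact h0.2)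
    · refine ⟨hσ.advance hA hh hhalf fun h1 h2 => h0 ⟨h1, h2⟩, hσ.potential_advance hA hh⟩

theorem search_runs (i : ℕ) : ∃ C, ∀ (n m : ℕ) (src dst : Fin m → Fin n) (lab : Fin m → ℕ),
    (∀ e, src e ≠ dst e) → ∀ s, HasInput src dst lab s → s.lists.Valid src dst (2 * m) →
    (∀ e, s.lists.Complete src dst (2 * m) e) → (∀ v, s.arr (10 + i) v = 0) →
    (∀ v, s.arr (20 + i) v = 0) → (∀ v, s.arr (30 + i) v = 0) →
    Runs (search i) s (C * (n + m + 1)) fun s' => Frame (search i) s s' ∧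
      SearchResult src dst lab i (s'.arr (10 + i)) (s'.arr (20 + i)) (s'.arr (30 + i)) := by
  refine ⟨searchInit.bound + (searchTest.cost + 1 + (searchBody i).bound) * 2,
    fun n m src dst lab hne s hin hA hc ho hp ht => ?_⟩
  set s₀ := searchInit.run s with hs₀
  have hf₀ : Frame searchInit s s₀ := by
    obtain ⟨t, -, he⟩ := Prog.LoopFree.exec (p := searchInit) (by simp [searchInit, Prog.LoopFree]) s
    exact he.frame
  have hin₀ : HasInput src dst lab s₀ := hin.frame hf₀ (by simp [searchInit, Prog.Writes])
    (by simp [searchInit, Prog.Writes]) (by simp [searchInit, Prog.Writes])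
    (by simp [searchInit, Prog.Assigns]) (by simp [searchInit, Prog.Assigns])
  have hinv : ∀ s', Frame (searchBody i) s₀ s' → HasInput src dst lab s' ∧ s'.lists = s.lists := by
    intro s' hf
    have hw : ∀ a < 9, s'.arr a = s.arr a := by
      intro a ha
      have e1 : ¬ a = 10 + i := by omega
      have e2 : ¬ a = 20 + i := by omega
      have e3 : ¬ a = 30 + i := by omega
      have e4 : ¬ a = 9 := by omega
      rw [hf.arr a (by simp [searchBody, scanProg, dequeueProg, rootProg, growProg, enqueueProg,
        incr, Prog.Writes, e1, e2, e3, e4]), hf₀.arr a (by simp [searchInit, Prog.Writes])]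
    have hr : ∀ r < 2, s'.reg r = s₀.reg r := by
      intro r hr
      apply hf.reg
      simp [searchBody, scanProg, dequeueProg, rootProg, growProg, enqueueProg, incr, Prog.Assigns]
      omega
    refine ⟨⟨?_, ?_, ?_, ?_, ?_⟩, ?_⟩
    · rw [hr 0 (by omega), hin₀.n_eq]
    · rw [hr 1 (by omega), hin₀.m_eq]
    · rw [hw 0 (by omega)]; exact hin.src_eq
    · rw [hw 1 (by omega)]; exact hin.dst_eq
    · rw [hw 2 (by omega)]; exact hin.lab_eq
    · simp [Store.lists, hw]
  have key := Runs.loop (b := searchTest) (p := searchBody i) (K := (searchBody i).bound)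
    (Inv := fun v s' => v = (s'.search i).potential n m s.lists ∧
      SearchInv src dst lab i s.lists (s'.search i)) (s₀ := s₀)
    (v := (s₀.search i).potential n m s.lists) ?_ ?_
  -- This is the source of the factor `2` in the constant: each vertex counts once as unprocessed
  -- and once as candidate for a root, and each edge as two half-edges.
  · have hpot : (s₀.search i).potential n m s.lists ≤ n + 2 * m + n := by
      refine Nat.add_le_add (Nat.add_le_add ?_ ?_) (Nat.sub_le _ _)
      · exact (Finset.card_filter_le _ _).trans (by simp)
      · exact (Finset.card_filter_le _ _).trans (by simp)
    have := (Prog.LoopFree.runs (p := searchInit) (s := s) (Q := (· = s₀))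
      (by simp [searchInit, Prog.LoopFree]) rfl).seq (q := .loop searchTest (searchBody i))
        fun s' hs' => by subst hs'; exact key
    refine this.frame.mono ?_ ?_
    · exact init_add_loop_le (by omega) (by omega)
    · rintro s' ⟨⟨hb, hf, v', -, hi⟩, hf'⟩
      refine ⟨hf', hi.result ?_⟩
      have hn := (hinv s' hf).1.n_eq
      simp only [searchTest, Test.Holds, Expr.eval, hn, not_not, not_lt] at hb
      exact hb.2.2
  · rintro v s' hf ⟨rfl, hi⟩ hb
    obtain ⟨hin', hl⟩ := hinv s' hf
    obtain ⟨h1, h2⟩ := hi.step hne hin' hA hc hl hb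
    exact Prog.LoopFree.runs (by simp [searchBody, scanProg, dequeueProg, rootProg, growProg,
      enqueueProg, incr, Prog.LoopFree]) ⟨_, h2, rfl, h1⟩
  · exact ⟨rfl, searchInv_init ho hp ht _⟩

end Programs

/-! ### Distributing the chords -/

section Chords

variable {n m : ℕ} {src dst : Fin m → Fin n} {lab : Fin m → ℕ}

theorem reachable_of_mem_ends (hne : ∀ e, src e ≠ dst e) {i : ℕ} {e : Fin m} (he : lab e = i)
    {x y : Fin n} (h : s(src e, dst e) = s(x, y)) :
    (labGraph src dst lab i).Reachable x (src e) := by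
  have hadj := edgeGraph_adj_of_mem hne (show e ∈ {e | lab e = i} from he) h
  rw [Sym2.eq_iff] at h
  rcases h with ⟨h, -⟩ | ⟨h, -⟩
  · rw [h]
  · rw [h]; exact hadj.reachable

/-- A component has at most one chord. -/
theorem SearchResult.chord_unique {i : ℕ} {ord par tree : ℕ → ℕ}
    (hR : SearchResult src dst lab i ord par tree) (hne : ∀ e, src e ≠ dst e)
    (hinj : ∀ e e', s(src e, dst e) = s(src e', dst e') → e = e')
    (hP : IsPseudoforest (labGraph src dst lab i)) {e e' : Fin m} (he : lab e = i)
    (hT : tree e ≠ 1) (he' : lab e' = i) (hT' : tree e' ≠ 1)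
    (h : (labGraph src dst lab i).Reachable (src e) (src e')) : e = e' := by
  have not_adj : ∀ f : Fin m, tree f ≠ 1 → ¬ (markGraph src dst tree).Adj (src f) (dst f) := by
    rintro f hf ⟨-, g, hg, hs⟩
    exact hf (hinj g f hs ▸ hg)
  exact hinj e e' (hP.chord_unique (edgeGraph_mono fun f hf => hR.lab_eq f hf) hR.span
    (edgeGraph_adj_of_mem hne he rfl) (not_adj e hT)
    (edgeGraph_adj_of_mem hne he' rfl) (not_adj e' hT') h)

/-- The order of discovery orients every edge, so the upper end in `top`, in `done` and in the
choice of a chord is always the same vertex. -/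
theorem upper_unique {ord : ℕ → ℕ} {e : Fin m} {v w v' w' : Fin n}
    (h : s(src e, dst e) = s(v, w)) (hlt : ord w < ord v) (h' : s(src e, dst e) = s(v', w'))
    (hlt' : ord w' < ord v') : v' = v ∧ w' = w := by
  rw [h, Sym2.eq_iff] at h'
  rcases h' with ⟨rfl, rfl⟩ | ⟨rfl, rfl⟩
  · exact ⟨rfl, rfl⟩
  · omega

theorem SearchResult.exists_upper {i : ℕ} {ord par tree : ℕ → ℕ}
    (hR : SearchResult src dst lab i ord par tree) (hne : ∀ e, src e ≠ dst e) (e : Fin m) :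
    ∃ v w, s(src e, dst e) = s(v, w) ∧ ord w < ord v := by
  rcases lt_trichotomy (ord (src e)) (ord (dst e)) with h | h | h
  · exact ⟨dst e, src e, Sym2.eq_swap, h⟩
  · exact absurd (hR.ord_inj _ _ h) (hne e)
  · exact ⟨src e, dst e, rfl, h⟩

/-- The spanning forest stays acyclic if chords replace the edges from their upper ends to the
parents. -/
theorem SearchResult.isAcyclic {i : ℕ} {ord par tree : ℕ → ℕ}
    (hR : SearchResult src dst lab i ord par tree) (hne : ∀ e, src e ≠ dst e)
    (hinj : ∀ e e', s(src e, dst e) = s(src e', dst e') → e = e')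
    (hP : IsPseudoforest (labGraph src dst lab i)) {S : Set (Fin m)} (hS : ∀ e ∈ S, lab e = i)
    (hchord : ∀ e ∈ S, tree e ≠ 1 → ∃ (v w : Fin n) (f : Fin m), s(src e, dst e) = s(v, w) ∧
      ord w < ord v ∧ par v = f + 1 ∧ f ∉ S) : (edgeGraph src dst S).IsAcyclic := by
  refine isAcyclic_of_top (fun v => ord v) (fun x y h he => h.ne (hR.ord_inj x y he)) ?_
  rintro v x y ⟨-, e, he, hs⟩ ⟨-, e', he', hs'⟩ hx hy
  have hpar : ∀ e ∈ S, ∀ x : Fin n, s(src e, dst e) = s(v, x) → ord x < ord v → tree e = 1 →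
      par v = e + 1 := by
    intro e he x hs hx ht
    obtain ⟨v', w', h1, h2, h3⟩ := hR.top e ht
    obtain ⟨rfl, rfl⟩ := upper_unique hs hx h1 h3
    exact h2
  -- A tree edge with upper end `v` is the edge from `v` to its parent, which is missing from `S` if
  -- a chord of `S` has upper end `v`.
  have mixed : ∀ e ∈ S, ∀ e' ∈ S, ∀ x y : Fin n, s(src e, dst e) = s(v, x) → ord x < ord v →
      s(src e', dst e') = s(v, y) → ord y < ord v → tree e = 1 → tree e' ≠ 1 → False := by
    intro e he e' he' x y hs hx hs' hy ht ht'
    obtain ⟨v', w', f, h1, h2, h3, h4⟩ := hchord e' he' ht'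
    obtain ⟨rfl, rfl⟩ := upper_unique hs' hy h1 h2
    have := hpar e he x hs hx ht
    exact h4 ((Fin.ext (by omega) : e = f) ▸ he)
  have heq : e = e' := by
    by_cases ht : tree e = 1 <;> by_cases ht' : tree e' = 1
    · have h1 := hpar e he x hs hx ht
      have h2 := hpar e' he' y hs' hy ht'
      exact Fin.ext (by omega)
    · exact (mixed e he e' he' x y hs hx hs' hy ht ht').elim
    · exact (mixed e' he' e he y x hs' hy hs hx ht' ht).elim
    -- Two chords with the same upper end lie in one component.
    · exact hR.chord_unique hne hinj hP (hS e he) ht (hS e' he') ht'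
        ((reachable_of_mem_ends hne (hS e he) hs).symm.trans
          (reachable_of_mem_ends hne (hS e' he') hs'))
  subst heq
  rw [hs] at hs'
  exact Sym2.congr_right.1 hs'

/-- The input graph and the results of the three searches. -/
structure Setup (src dst : Fin m → Fin n) (lab : Fin m → ℕ) (ord par tree : ℕ → ℕ → ℕ) : Prop where
  ne : ∀ e, src e ≠ dst e
  inj : ∀ e e', s(src e, dst e) = s(src e', dst e') → e = e'
  lab_lt : ∀ e, lab e < 3
  pseudo : ∀ i < 3, IsPseudoforest (labGraph src dst lab i)
  result : ∀ i < 3, SearchResult src dst lab i (ord i) (par i) (tree i)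

/-- The invariant of the distribution of the chords, after the edges below `k`. -/
structure ChordInv (src dst : Fin m → Fin n) (lab : Fin m → ℕ) (ord par tree : ℕ → ℕ → ℕ)
    (k : ℕ) (out : ℕ → ℕ) (fin : Fin n → Fin n) : Prop where
  out_cases : ∀ e : Fin m, out e = lab e ∨ (out e = 3 ∧ lab e < 2) ∨
    (out e = 4 ∧ lab e = 2 ∧ tree 2 e ≠ 1)
  chord : ∀ e : Fin m, out e = 3 → ∃ g : Fin m, (g : ℕ) < k ∧ lab g = lab e ∧
    tree (lab g) g ≠ 1 ∧ (labGraph src dst lab (lab g)).Reachable (src e) (src g)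
  unique : ∀ e e' : Fin m, out e = 3 → out e' = 3 → lab e = lab e' →
    (labGraph src dst lab (lab e)).Reachable (src e) (src e') → e = e'
  done : ∀ g : Fin m, (g : ℕ) < k → lab g < 2 → tree (lab g) g ≠ 1 → out g = 3 ∨
    ∃ (v w : Fin n) (f : Fin m), s(src g, dst g) = s(v, w) ∧ ord (lab g) w < ord (lab g) v ∧
      par (lab g) v = f + 1 ∧ out f = 3
  done_two : ∀ g : Fin m, (g : ℕ) < k → lab g = 2 → tree 2 g ≠ 1 → out g = 4
  ends : PathEnds (edgeGraph src dst {e : Fin m | out e = 3}) fin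

variable {ord par tree : ℕ → ℕ → ℕ} {out : ℕ → ℕ} {fin : Fin n → Fin n}

theorem ChordInv.init (hset : Setup src dst lab ord par tree) (hout : ∀ e : Fin m, out e = lab e) :
    ChordInv src dst lab ord par tree 0 out id := by
  have h3 : ∀ e : Fin m, out e ≠ 3 := fun e h => by
    have := hset.lab_lt e
    rw [hout e] at h; omega
  refine ⟨fun e => .inl (hout e), fun e h => absurd h (h3 e), fun e e' h => absurd h (h3 e),
    fun g hg => absurd hg (Nat.not_lt_zero _), fun g hg => absurd hg (Nat.not_lt_zero _), ?_⟩
  have : edgeGraph src dst {e : Fin m | out e = 3} = ⊥ := by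
    ext x y
    simp only [edgeGraph_adj, Set.mem_ofPred_eq, bot_adj, iff_false]
    rintro ⟨-, e, he, -⟩
    exact h3 e he
  rw [this]
  exact .bot

theorem ChordInv.lab_lt_two (hset : Setup src dst lab ord par tree) {k : ℕ}
    (h : ChordInv src dst lab ord par tree k out fin) {e : Fin m} (he : out e = 3) : lab e < 2 := by
  have := hset.lab_lt e
  rcases h.out_cases e with h | h | h <;> omega

/-- Edges that need no action. -/
theorem ChordInv.skip {e : Fin m} (h : ChordInv src dst lab ord par tree e out fin)
    (ht : tree (lab e) e = 1) : ChordInv src dst lab ord par tree (e + 1) out fin where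
  out_cases := h.out_cases
  chord f hf := by
    obtain ⟨g, h1, h2⟩ := h.chord f hf
    exact ⟨g, by omega, h2⟩
  unique := h.unique
  done g hg hl hg' := by
    rcases Nat.lt_succ_iff_lt_or_eq.1 hg with hg | hg
    · exact h.done g hg hl hg'
    · exact absurd (Fin.ext hg ▸ ht) hg'
  done_two g hg hl hg' := by
    rcases Nat.lt_succ_iff_lt_or_eq.1 hg with hg | hg
    · exact h.done_two g hg hl hg'
    · rw [← Fin.ext hg, hl] at ht
      exact absurd ht hg'
  ends := h.ends

/-- Chords of the third pseudoforest. -/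
theorem ChordInv.third {e : Fin m}
    (h : ChordInv src dst lab ord par tree e out fin) (he : lab e = 2) (ht : tree 2 e ≠ 1) :
    ChordInv src dst lab ord par tree (e + 1) (Function.update out e 4) fin := by
  have out_e : Function.update out (e : ℕ) 4 e = 4 := by simp
  have out_ne : ∀ f : Fin m, f ≠ e → Function.update out (e : ℕ) 4 f = out f := fun f hf => by
    simp [Fin.val_inj, hf]
  have out_three : ∀ f : Fin m, Function.update out (e : ℕ) 4 f = 3 → out f = 3 := fun f hf => by
    by_cases hfe : f = e
    · rw [hfe, out_e] at hf; omega
    · rwa [out_ne f hfe] at hf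
  have lab_three : ∀ f : Fin m, out f = 3 → f ≠ e := by
    rintro f hf rfl
    rcases h.out_cases f with h | h | h <;> omega
  refine ⟨?_, ?_, ?_, ?_, ?_, ?_⟩
  · intro f
    by_cases hfe : f = e
    · rw [hfe]; exact .inr (.inr ⟨out_e, he, ht⟩)
    · rw [out_ne f hfe]; exact h.out_cases f
  · intro f hf
    obtain ⟨g, h1, h2⟩ := h.chord f (out_three f hf)
    exact ⟨g, by omega, h2⟩
  · exact fun f f' hf hf' => h.unique f f' (out_three f hf) (out_three f' hf')
  · intro g hg hl hg'
    have hge : g ≠ e := fun h => by rw [h] at hl; omega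
    have : (g : ℕ) ≠ e := fun h => hge (Fin.ext h)
    rcases h.done g (by omega) hl hg' with h1 | ⟨v, w, f, h1, h2, h3, h4⟩
    · exact .inl (by rw [out_ne g hge]; exact h1)
    · exact .inr ⟨v, w, f, h1, h2, h3, by rw [out_ne f (lab_three f h4)]; exact h4⟩
  · intro g hg hl hg'
    by_cases hge : g = e
    · rw [hge, out_e]
    · have : (g : ℕ) ≠ e := fun h => hge (Fin.ext h)
      rw [out_ne g hge]
      exact h.done_two g (by omega) hl hg'
  · have : {f : Fin m | Function.update out (e : ℕ) 4 f = 3} = {f : Fin m | out f = 3} := by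
      ext f
      exact ⟨out_three f, fun hf => by
        change Function.update out (e : ℕ) 4 f = 3
        rw [out_ne f (lab_three f hf)]; exact hf⟩
    rw [this]; exact h.ends

/-- No edge of the linear forest lies in the component of a chord with the same label that was not
treated yet. -/
theorem ChordInv.not_old (hset : Setup src dst lab ord par tree) {e : Fin m}
    (h : ChordInv src dst lab ord par tree e out fin) (ht : tree (lab e) e ≠ 1)
    {f : Fin m} (hf : out f = 3) (hl : lab f = lab e) :
    ¬ (labGraph src dst lab (lab e)).Reachable (src f) (src e) := by
  intro hr
  obtain ⟨g, h1, h2, h3, h4⟩ := h.chord f hf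
  have hlg : lab g = lab e := h2.trans hl
  rw [hlg] at h3 h4
  have hle := hset.lab_lt e
  have := (hset.result _ hle).chord_unique hset.ne hset.inj (hset.pseudo _ hle) hlg h3 rfl ht
    (h4.symm.trans hr)
  rw [this] at h1
  omega

/-- No edge with the label of `e` has been moved out of this component. Hence a moved edge at `x`
has the other one of the labels `0` and `1`, and `unique` allows only one such edge at `x`. -/
theorem ChordInv.low (hset : Setup src dst lab ord par tree) {e : Fin m}
    (h : ChordInv src dst lab ord par tree e out fin) (hlt : lab e < 2)
    (ht : tree (lab e) e ≠ 1) {x : Fin n}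
    (hx : (labGraph src dst lab (lab e)).Reachable x (src e)) :
    Low (edgeGraph src dst {e : Fin m | out e = 3}) x := by
  rintro y z ⟨-, f, hf, hs⟩ ⟨-, f', hf', hs'⟩
  have other : ∀ {f : Fin m} {y : Fin n}, out f = 3 → s(src f, dst f) = s(x, y) →
      lab f ≠ lab e := fun {f y} hf hs hl =>
    h.not_old hset ht hf hl ((reachable_of_mem_ends hset.ne hl hs).symm.trans hx)
  have h1 := other hf hs
  have h2 := other hf' hs'
  have h3 := h.lab_lt_two hset hf
  have h4 := h.lab_lt_two hset hf'
  have hl : lab f = lab f' := by omega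
  obtain rfl := h.unique f f' hf hf' hl ((reachable_of_mem_ends hset.ne rfl hs).symm.trans
    (reachable_of_mem_ends hset.ne hl.symm hs'))
  rw [hs] at hs'
  exact Sym2.congr_right.1 hs'

/-- Moving an edge `g` with end vertices `x` and `y` to the linear forest. -/
theorem ChordInv.move (hset : Setup src dst lab ord par tree) {e g : Fin m}
    (h : ChordInv src dst lab ord par tree e out fin) (hlt : lab e < 2)
    (ht : tree (lab e) e ≠ 1) {x y : Fin n} (hg : s(src g, dst g) = s(x, y)) (hlg : lab g = lab e)
    (hr : (labGraph src dst lab (lab e)).Reachable (src g) (src e)) (hxy : fin x ≠ y)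
    (hdone : g = e ∨ ∃ v w : Fin n, s(src e, dst e) = s(v, w) ∧
      ord (lab e) w < ord (lab e) v ∧ par (lab e) v = g + 1) :
    ChordInv src dst lab ord par tree (e + 1) (Function.update out g 3)
      (Function.update (Function.update fin (fin x) (fin y)) (fin y) (fin x)) := by
  have out_g : Function.update out (g : ℕ) 3 g = 3 := by simp
  have out_ne : ∀ f : Fin m, f ≠ g → Function.update out (g : ℕ) 3 f = out f := fun f hf => by
    simp [Fin.val_inj, hf]
  have out_three : ∀ f : Fin m, out f = 3 → Function.update out (g : ℕ) 3 f = 3 := fun f hf => by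
    by_cases hfg : f = g
    · rw [hfg, out_g]
    · rw [out_ne f hfg, hf]
  have hset_eq : {f : Fin m | Function.update out (g : ℕ) 3 f = 3} =
      insert g {f : Fin m | out f = 3} := by
    ext f
    by_cases hfg : f = g
    · simp [hfg]
    · simp [hfg, Fin.val_inj]
  have ne_xy : x ≠ y := (edgeGraph_adj_of_mem hset.ne (Set.mem_univ g) hg).ne
  have rx := (reachable_of_mem_ends hset.ne hlg hg).trans hr
  have ry := (reachable_of_mem_ends hset.ne hlg (hg.trans Sym2.eq_swap)).trans hr
  refine ⟨?_, ?_, ?_, ?_, ?_, ?_⟩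
  · intro f
    by_cases hfg : f = g
    · rw [hfg]; exact .inr (.inl ⟨out_g, by omega⟩)
    · rw [out_ne f hfg]; exact h.out_cases f
  · intro f hf
    by_cases hfg : f = g
    · rw [hfg]; exact ⟨e, by omega, hlg.symm, ht, hr⟩
    · rw [out_ne f hfg] at hf
      obtain ⟨g', h1, h2⟩ := h.chord f hf
      exact ⟨g', by omega, h2⟩
  · intro f f' hf hf' hl hr'
    by_cases hfg : f = g <;> by_cases hfg' : f' = g
    · rw [hfg, hfg']
    · rw [out_ne f' hfg'] at hf'
      subst hfg
      rw [hlg] at hr'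
      exact absurd (hr'.symm.trans hr) (h.not_old hset ht hf' (hl.symm.trans hlg))
    · rw [out_ne f hfg] at hf
      subst hfg'
      rw [hl, hlg] at hr'
      exact absurd (hr'.trans hr) (h.not_old hset ht hf (hl.trans hlg))
    · rw [out_ne f hfg] at hf
      rw [out_ne f' hfg'] at hf'
      exact h.unique f f' hf hf' hl hr'
  · intro g' hg' hl hT
    rcases Nat.lt_succ_iff_lt_or_eq.1 hg' with hg' | hg'
    · rcases h.done g' hg' hl hT with h1 | ⟨v, w, f, h1, h2, h3, h4⟩
      · exact .inl (out_three g' h1)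
      · exact .inr ⟨v, w, f, h1, h2, h3, out_three f h4⟩
    · obtain rfl : g' = e := Fin.ext hg'
      rcases hdone with rfl | ⟨v, w, h1, h2, h3⟩
      · exact .inl out_g
      · exact .inr ⟨v, w, g, h1, h2, h3, out_g⟩
  · intro g' hg' hl hT
    have hne : g' ≠ e := fun hh => by rw [hh] at hl; omega
    have hne' : g' ≠ g := fun hh => by rw [hh] at hl; omega
    have : (g' : ℕ) ≠ e := fun hh => hne (Fin.ext hh)
    rw [out_ne g' hne']
    exact h.done_two g' (by omega) hl hT
  · have hedge : edge (src g) (dst g) = edge x y := by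
      simp only [edge, hg]
    rw [hset_eq, edgeGraph_insert, hedge]
    exact h.ends.join ne_xy (h.low hset hlt ht rx) (h.low hset hlt ht ry) hxy

/-- A chord `e` whose upper end is `v`, with `f` the edge from `v` to its parent `w`. -/
structure IsChord (src dst : Fin m → Fin n) (lab : Fin m → ℕ) (ord par : ℕ → ℕ → ℕ)
    (e f : Fin m) (u v w : Fin n) : Prop where
  ends : s(src e, dst e) = s(v, u)
  lt : ord (lab e) u < ord (lab e) v
  par_eq : par (lab e) v = f + 1
  lab_eq : lab f = lab e
  ends' : s(src f, dst f) = s(v, w)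
  ne : u ≠ w

/-- The upper end has an earlier vertex in its component, so it is not a root and has a parent. The
parent is not the lower end of the chord, since there are no parallel edges and the chord is not a
tree edge. -/
theorem Setup.exists_isChord (hset : Setup src dst lab ord par tree) {e : Fin m}
    (ht : tree (lab e) e ≠ 1) : ∃ f u v w, IsChord src dst lab ord par e f u v w := by
  have hR := hset.result _ (hset.lab_lt e)
  obtain ⟨v, u, h1, h2⟩ := hR.exists_upper hset.ne e
  have hr : (labGraph src dst lab (lab e)).Reachable u v :=
    (edgeGraph_adj_of_mem hset.ne (show e ∈ {f | lab f = lab e} from rfl) h1).symm.reachable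
  obtain ⟨f, w, h3, h4, h5, h6⟩ := hR.parent v u hr h2
  refine ⟨f, u, v, w, h1, h2, h3, hR.lab_eq f h4, h5, ?_⟩
  rintro rfl
  exact ht (hset.inj e f (h1.trans h5.symm) ▸ h4)

theorem ChordInv.keep (hset : Setup src dst lab ord par tree) {e f : Fin m} {u v w : Fin n}
    (h : ChordInv src dst lab ord par tree e out fin) (hlt : lab e < 2)
    (ht : tree (lab e) e ≠ 1) (hc : IsChord src dst lab ord par e f u v w) (huv : fin u ≠ v) :
    ChordInv src dst lab ord par tree (e + 1) (Function.update out e 3)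
      (Function.update (Function.update fin (fin u) (fin v)) (fin v) (fin u)) :=
  h.move hset hlt ht (hc.ends.trans Sym2.eq_swap) rfl (.refl _) huv (.inl rfl)

/-- The chord would close a cycle, so the edge to the parent is moved instead. -/
theorem ChordInv.swap (hset : Setup src dst lab ord par tree) {e f : Fin m} {u v w : Fin n}
    (h : ChordInv src dst lab ord par tree e out fin) (hlt : lab e < 2)
    (ht : tree (lab e) e ≠ 1) (hc : IsChord src dst lab ord par e f u v w) (huv : fin u = v) :
    ChordInv src dst lab ord par tree (e + 1) (Function.update out f 3)
      (Function.update (Function.update fin (fin w) (fin v)) (fin v) (fin w)) := by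
  have rv := reachable_of_mem_ends (lab := lab) hset.ne rfl hc.ends
  have ru := reachable_of_mem_ends (lab := lab) hset.ne rfl (hc.ends.trans Sym2.eq_swap)
  have rvf := reachable_of_mem_ends hset.ne hc.lab_eq hc.ends'
  have rwf := reachable_of_mem_ends hset.ne hc.lab_eq (hc.ends'.trans Sym2.eq_swap)
  have hr : (labGraph src dst lab (lab e)).Reachable (src f) (src e) := rvf.symm.trans rv
  refine h.move hset hlt ht (hc.ends'.trans Sym2.eq_swap) hc.lab_eq hr ?_
    (.inr ⟨v, u, hc.ends, hc.lt, hc.par_eq⟩)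
  -- Otherwise `v` would be opposite to both `u` and `w`, and the involution would give `u = w`.
  intro hwv
  have h1 := h.ends.invol u (h.low hset hlt ht ru)
  have h2 := h.ends.invol w (h.low hset hlt ht (rwf.trans hr))
  rw [huv] at h1
  rw [hwv] at h2
  exact hc.ne (h1.symm.trans h2)

/-- The resulting parts. -/
abbrev outGraph (src dst : Fin m → Fin n) (out : ℕ → ℕ) (j : ℕ) : SimpleGraph (Fin n) :=
  edgeGraph src dst {e | out e = j}

/-- All chords have been treated, so a chord that remains here was spared because the edge from its
upper end to the parent was moved. This is the hypothesis of `SearchResult.isAcyclic`. -/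
theorem ChordInv.isAcyclic_of_lt_two (hset : Setup src dst lab ord par tree)
    (h : ChordInv src dst lab ord par tree m out fin) {c : ℕ} (hc : c < 2) :
    (outGraph src dst out c).IsAcyclic := by
  have hlab : ∀ e : Fin m, out e = c → lab e = c := fun e he => by
    rcases h.out_cases e with h | h | h <;> omega
  refine (hset.result c (by omega)).isAcyclic hset.ne hset.inj (hset.pseudo c (by omega)) hlab ?_
  intro e he ht
  have he' := hlab e he
  rcases h.done e e.2 (by omega) (by rw [he']; exact ht) with h1 | ⟨v, w, f, h1, h2, h3, h4⟩
  · have : out e = c := he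
    omega
  · rw [he'] at h2 h3
    refine ⟨v, w, f, h1, h2, h3, fun hf => ?_⟩
    have : out f = c := hf
    omega

/-- No chord of the third pseudoforest remains, so only tree edges are left. -/
theorem ChordInv.isAcyclic_two (hset : Setup src dst lab ord par tree)
    (h : ChordInv src dst lab ord par tree m out fin) : (outGraph src dst out 2).IsAcyclic := by
  have hlab : ∀ e : Fin m, out e = 2 → lab e = 2 := fun e he => by
    rcases h.out_cases e with h | h | h <;> omega
  refine (hset.result 2 (by omega)).isAcyclic hset.ne hset.inj (hset.pseudo 2 (by omega)) hlab ?_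
  intro e he ht
  have := h.done_two e e.2 (hlab e he) ht
  have : out e = 2 := he
  omega

theorem ChordInv.isLinearForest_three (h : ChordInv src dst lab ord par tree m out fin) :
    IsLinearForest (outGraph src dst out 3) :=
  isLinearForest_of_degLeTwo h.ends.acyclic h.ends.deg

/-- Two chords with a common vertex would lie in one component, so this part is a matching. -/
theorem ChordInv.isLinearForest_four (hset : Setup src dst lab ord par tree)
    (h : ChordInv src dst lab ord par tree m out fin) :
    IsLinearForest (outGraph src dst out 4) := by
  have hlab : ∀ e : Fin m, out e = 4 → lab e = 2 ∧ tree 2 e ≠ 1 := fun e he => by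
    have := hset.lab_lt e
    rcases h.out_cases e with h | h | h
    · omega
    · omega
    · exact h.2
  have hlow : ∀ x, Low (outGraph src dst out 4) x := by
    rintro x y z ⟨-, e, he, hs⟩ ⟨-, e', he', hs'⟩
    obtain ⟨h1, h2⟩ := hlab e he
    obtain ⟨h1', h2'⟩ := hlab e' he'
    obtain rfl := (hset.result 2 (by omega)).chord_unique hset.ne hset.inj
      (hset.pseudo 2 (by omega)) h1 h2 h1' h2' ((reachable_of_mem_ends hset.ne h1 hs).symm.trans
        (reachable_of_mem_ends hset.ne h1' hs'))
    rw [hs] at hs'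
    exact Sym2.congr_right.1 hs'
  exact isLinearForest_of_degLeTwo (isAcyclic_of_low hlow)
    fun x y z w hy hz _ => .inl (hlow x y z hy hz)

end Chords

/-! ### The program that distributes the chords -/

/-- Registers `12` and `13` receive the lower and the upper end of edge `reg 2`, register `14` the
edge from the upper end to its parent. -/
def chordEnds (c : ℕ) : Prog :=
  .seq (.assign 12 (.read 0 (.reg 2))) <|
  .seq (.assign 13 (.read 1 (.reg 2))) <|
  .seq (.ite (.lt (.read (10 + c) (.reg 13)) (.read (10 + c) (.reg 12)))
    (.seq (.assign 12 (.read 1 (.reg 2))) (.assign 13 (.read 0 (.reg 2)))) .skip) <|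
  .assign 14 (.pred (.read (20 + c) (.reg 13)))

/-- Choose between the chord and the edge to the parent. -/
def chordMove : Prog :=
  .ite (.eq (.read 40 (.reg 12)) (.reg 13))
    (.seq (.write 3 (.reg 14) (.const 3)) <|
      .ite (.eq (.read 0 (.reg 14)) (.reg 13)) (.assign 12 (.read 1 (.reg 14)))
        (.assign 12 (.read 0 (.reg 14))))
    (.write 3 (.reg 2) (.const 3))

/-- Join the paths ending in registers `12` and `13`. -/
def joinProg : Prog :=
  .seq (.assign 14 (.read 40 (.reg 12))) <|
  .seq (.assign 15 (.read 40 (.reg 13))) <|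
  .seq (.write 40 (.reg 14) (.reg 15)) <|
  .write 40 (.reg 15) (.reg 14)

def chordProg (c : ℕ) : Prog := .seq (chordEnds c) (.seq chordMove joinProg)

/-- Edge `reg 2` is a chord with label `c`. -/
def chordTest (c : ℕ) : Test :=
  .and (.eq (.read 2 (.reg 2)) (.const c)) (.not (.eq (.read (30 + c) (.reg 2)) (.const 1)))

def distributeBody : Prog :=
  .seq (.ite (chordTest 0) (chordProg 0) <| .ite (chordTest 1) (chordProg 1) <|
    .ite (chordTest 2) (.write 3 (.reg 2) (.const 4)) .skip) <|
  incr 2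

def distribute : Prog :=
  .seq (.assign 2 (.const 0)) (.loop (.lt (.reg 2) (.reg 1)) distributeBody)

/-- The whole algorithm. -/
def convert : Prog :=
  .seq build <| .seq initEnds <| .seq (search 0) <| .seq (search 1) <| .seq (search 2) distribute

section Distribute

variable {n m : ℕ} {src dst : Fin m → Fin n} {lab : Fin m → ℕ}

/-- Array `40` represents `fin`. -/
def HasEnds (s : Store) (fin : Fin n → Fin n) : Prop := ∀ v : Fin n, s.arr 40 v = fin v

/-- Both opposite ends are read into registers before either entry is overwritten, so the writes
realise the update of `PathEnds.join`. -/
theorem hasEnds_join {s : Store} {fin : Fin n → Fin n} (h : HasEnds s fin) {x y : Fin n}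
    (hx : s.reg 12 = x) (hy : s.reg 13 = y) :
    HasEnds (joinProg.run s)
      (Function.update (Function.update fin (fin x) (fin y)) (fin y) (fin x)) := by
  intro v
  have : (joinProg.run s).arr 40 =
      Function.update (Function.update (s.arr 40) (fin x) (fin y)) (fin y) (fin x) := by
    simp [joinProg, Prog.run, Expr.eval, hx, hy, h x, h y]
  rw [this]
  simp only [Function.update_apply, Fin.val_inj]
  split_ifs <;> simp [h v]

theorem joinProg_arr_three (s : Store) : (joinProg.run s).arr 3 = s.arr 3 := by
  simp [joinProg, Prog.run, Expr.eval]

theorem chordEnds_arr (c : ℕ) (s : Store) : ((chordEnds c).run s).arr = s.arr := by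
  by_cases h : s.arr (10 + c) (s.arr 1 (s.reg 2)) < s.arr (10 + c) (s.arr 0 (s.reg 2)) <;>
    simp [chordEnds, Prog.run, Expr.eval, Test.Holds, h]

theorem chordEnds_reg_two (c : ℕ) (s : Store) : ((chordEnds c).run s).reg 2 = s.reg 2 := by
  by_cases h : s.arr (10 + c) (s.arr 1 (s.reg 2)) < s.arr (10 + c) (s.arr 0 (s.reg 2)) <;>
    simp [chordEnds, Prog.run, Expr.eval, Test.Holds, h]

theorem chordEnds_reg {s : Store} (hin : HasInput src dst lab s) {e f : Fin m} {u v w : Fin n}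
    (he : s.reg 2 = e) {c : ℕ} (hce : lab e = c) (hc : IsChord src dst lab
      (fun i => s.arr (10 + i)) (fun i => s.arr (20 + i)) e f u v w) :
    ((chordEnds c).run s).reg 12 = u ∧ ((chordEnds c).run s).reg 13 = v ∧
      ((chordEnds c).run s).reg 14 = f := by
  subst hce
  have hlt := hc.lt
  have hpar := hc.par_eq
  have hends := hc.ends
  rw [Sym2.eq_iff] at hends
  rcases hends with ⟨h1, h2⟩ | ⟨h1, h2⟩
  · simp [chordEnds, Prog.run, Expr.eval, Test.Holds, he, hin.src_eq, hin.dst_eq, h1, h2, hlt, hpar]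
  · have hn : ¬ s.arr (10 + lab e) v < s.arr (10 + lab e) u := by omega
    simp [chordEnds, Prog.run, Expr.eval, Test.Holds, he, hin.src_eq, hin.dst_eq, h1, h2, hn, hpar]

theorem chordProg_spec {s : Store} (hin : HasInput src dst lab s) {fin : Fin n → Fin n}
    (hfin : HasEnds s fin) {ord par tree : ℕ → ℕ → ℕ} (hset : Setup src dst lab ord par tree)
    (hord : ∀ i < 3, s.arr (10 + i) = ord i) (hpar : ∀ i < 3, s.arr (20 + i) = par i)
    {e : Fin m} (he : s.reg 2 = e) {c : ℕ} (hce : lab e = c) (hlt : lab e < 2)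
    (ht : tree (lab e) e ≠ 1) (hinv : ChordInv src dst lab ord par tree e (s.arr 3) fin) :
    ∃ fin' : Fin n → Fin n, HasEnds ((chordProg c).run s) fin' ∧
      ChordInv src dst lab ord par tree (e + 1) (((chordProg c).run s).arr 3) fin' := by
  obtain ⟨f, u, v, w, hc⟩ := hset.exists_isChord ht
  have hc' : IsChord src dst lab (fun i => s.arr (10 + i)) (fun i => s.arr (20 + i)) e f u v w :=
    ⟨hc.ends, by simp only [hord _ (hset.lab_lt e)]; exact hc.lt,
      by simp only [hpar _ (hset.lab_lt e)]; exact hc.par_eq, hc.lab_eq, hc.ends', hc.ne⟩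
  obtain ⟨h12, h13, h14⟩ := chordEnds_reg hin he hce hc'
  have harr := chordEnds_arr c s
  have h2 := (chordEnds_reg_two c s).trans he
  set s₁ := (chordEnds c).run s
  have hrun : (chordProg c).run s = joinProg.run (chordMove.run s₁) := rfl
  rw [hrun, joinProg_arr_three]
  -- The two cases are those of `chordMove`: if the chord would close a cycle, register `12` is
  -- redirected from `u` to the parent `w`; otherwise the chord itself is moved.
  by_cases huv : fin u = v
  · have m3 : (chordMove.run s₁).arr 3 = Function.update (s.arr 3) f 3 := by
      simp only [chordMove, Prog.run, Test.Holds, Expr.eval, h12, h13, h14, harr, hfin u, huv]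
      split_ifs <;> simp_all
    have m40 : HasEnds (chordMove.run s₁) fin := by
      intro z
      simp only [chordMove, Prog.run, Test.Holds, Expr.eval, h12, h13, h14, harr, hfin u, huv]
      split_ifs <;> simp_all [hfin z]
    have m13 : (chordMove.run s₁).reg 13 = v := by
      simp only [chordMove, Prog.run, Test.Holds, Expr.eval, h12, h13, h14, harr, hfin u, huv]
      split_ifs <;> simp_all
    have m12 : (chordMove.run s₁).reg 12 = w := by
      have hends := hc.ends'
      -- If the edge to the parent is listed with `w` first, the test for `v` in the program must
      -- fail.
      have hvw : w ≠ v := (edgeGraph_adj_of_mem hset.ne (Set.mem_univ f) hends).ne.symm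
      rw [Sym2.eq_iff] at hends
      rcases hends with ⟨h3, h4⟩ | ⟨h3, h4⟩
      · simp [chordMove, Prog.run, Test.Holds, Expr.eval, h12, h13, h14, harr, hfin u, huv,
          hin.src_eq, hin.dst_eq, h3, h4]
      · simp [chordMove, Prog.run, Test.Holds, Expr.eval, h12, h13, h14, harr, hfin u, huv,
          hin.src_eq, h3, Fin.val_inj, hvw]
    rw [m3]
    exact ⟨_, hasEnds_join m40 m12 m13, hinv.swap hset hlt ht hc huv⟩
  · have huv' : ¬ (fin u : ℕ) = v := fun h => huv (Fin.ext h)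
    have hrun' : chordMove.run s₁ = s₁.setArr 3 e 3 := by
      simp [chordMove, Prog.run, Test.Holds, Expr.eval, h2, h12, h13, harr, hfin u, huv']
    rw [hrun']
    have m3 : (s₁.setArr 3 e 3).arr 3 = Function.update (s.arr 3) e 3 := by simp [harr]
    have m40 : HasEnds (s₁.setArr 3 e 3) fin := fun z => by simpa [harr] using hfin z
    rw [m3]
    exact ⟨_, hasEnds_join m40 h12 h13, hinv.keep hset hlt ht hc huv⟩

/-- The state of the store during `distribute`. -/
structure DistInv (src dst : Fin m → Fin n) (lab : Fin m → ℕ) (ord par tree : ℕ → ℕ → ℕ)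
    (s : Store) : Prop where
  le : s.reg 2 ≤ m
  inv : ∃ fin : Fin n → Fin n, HasEnds s fin ∧
    ChordInv src dst lab ord par tree (s.reg 2) (s.arr 3) fin

theorem chordTest_holds {s : Store} (hin : HasInput src dst lab s) {e : Fin m} (he : s.reg 2 = e)
    (c : ℕ) : (chordTest c).Holds s ↔ lab e = c ∧ s.arr (30 + c) e ≠ 1 := by
  simp [chordTest, Test.Holds, Expr.eval, he, hin.lab_eq]

theorem DistInv.step {s : Store} (hin : HasInput src dst lab s) {ord par tree : ℕ → ℕ → ℕ}
    (hset : Setup src dst lab ord par tree)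
    (hord : ∀ i < 3, s.arr (10 + i) = ord i) (hpar : ∀ i < 3, s.arr (20 + i) = par i)
    (htree : ∀ i < 3, s.arr (30 + i) = tree i) (h : DistInv src dst lab ord par tree s)
    (hlt : s.reg 2 < m) : DistInv src dst lab ord par tree (distributeBody.run s) ∧
      (distributeBody.run s).reg 2 = s.reg 2 + 1 := by
  obtain ⟨e, he⟩ : ∃ e : Fin m, s.reg 2 = e := ⟨⟨_, hlt⟩, rfl⟩
  obtain ⟨fin, hfin, hinv⟩ := h.inv
  rw [he] at hinv
  have t0 := chordTest_holds hin he 0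
  have t1 := chordTest_holds hin he 1
  have t2 := chordTest_holds hin he 2
  rw [htree 0 (by omega)] at t0
  rw [htree 1 (by omega)] at t1
  rw [htree 2 (by omega)] at t2
  -- a loop-free step that leaves the counter alone
  have main : ∀ s' : Store, distributeBody.run s = (incr 2).run s' → s'.reg 2 = s.reg 2 →
      (∃ fin' : Fin n → Fin n, HasEnds s' fin' ∧
        ChordInv src dst lab ord par tree (e + 1) (s'.arr 3) fin') →
      DistInv src dst lab ord par tree (distributeBody.run s) ∧
        (distributeBody.run s).reg 2 = s.reg 2 + 1 := by
    rintro s' hrun h2 ⟨fin', hf', hi'⟩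
    have hr2 : (distributeBody.run s).reg 2 = s.reg 2 + 1 := by
      rw [hrun]; simp [incr, Prog.run, Expr.eval, h2]
    refine ⟨⟨by omega, fin', ?_, ?_⟩, hr2⟩
    · intro v; rw [hrun]; exact hf' v
    · rw [hr2, he, hrun]; exact hi'
  have keep2 : ∀ c, ((chordProg c).run s).reg 2 = s.reg 2 := by
    intro c
    obtain ⟨t, -, hx⟩ := Prog.LoopFree.exec (p := chordProg c)
      (by simp [chordProg, chordEnds, chordMove, joinProg, Prog.LoopFree]) s
    exact hx.frame.reg 2 (by simp [chordProg, chordEnds, chordMove, joinProg, Prog.Assigns])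
  by_cases ht : tree (lab e) e = 1
  · have n0 : ¬ (chordTest 0).Holds s := fun h => (t0.1 h).2 ((t0.1 h).1 ▸ ht)
    have n1 : ¬ (chordTest 1).Holds s := fun h => (t1.1 h).2 ((t1.1 h).1 ▸ ht)
    have n2 : ¬ (chordTest 2).Holds s := fun h => (t2.1 h).2 ((t2.1 h).1 ▸ ht)
    exact main s (by simp [distributeBody, Prog.run, n0, n1, n2]) rfl ⟨fin, hfin, hinv.skip ht⟩
  · have h3 := hset.lab_lt e
    obtain hl | hl | hl : lab e = 0 ∨ lab e = 1 ∨ lab e = 2 := by omega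
    · have y0 : (chordTest 0).Holds s := t0.2 ⟨hl, hl ▸ ht⟩
      exact main _ (by simp [distributeBody, Prog.run, y0]) (keep2 0)
        (chordProg_spec hin hfin hset hord hpar he hl (by omega) ht hinv)
    · have n0 : ¬ (chordTest 0).Holds s := fun h => by have := (t0.1 h).1; omega
      have y1 : (chordTest 1).Holds s := t1.2 ⟨hl, hl ▸ ht⟩
      exact main _ (by simp [distributeBody, Prog.run, n0, y1]) (keep2 1)
        (chordProg_spec hin hfin hset hord hpar he hl (by omega) ht hinv)
    · have n0 : ¬ (chordTest 0).Holds s := fun h => by have := (t0.1 h).1; omega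
      have n1 : ¬ (chordTest 1).Holds s := fun h => by have := (t1.1 h).1; omega
      have y2 : (chordTest 2).Holds s := t2.2 ⟨hl, hl ▸ ht⟩
      refine main (s.setArr 3 e 4)
        (by simp [distributeBody, Prog.run, n0, n1, y2, Expr.eval, he]) rfl ⟨fin, ?_, ?_⟩
      · intro v; simpa using hfin v
      · simpa using hinv.third hl (hl ▸ ht)

theorem distribute_runs : ∃ C, ∀ (n m : ℕ) (src dst : Fin m → Fin n) (lab : Fin m → ℕ)
    (ord par tree : ℕ → ℕ → ℕ) (s : Store), HasInput src dst lab s →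
    Setup src dst lab ord par tree → (∀ i < 3, s.arr (10 + i) = ord i) →
    (∀ i < 3, s.arr (20 + i) = par i) → (∀ i < 3, s.arr (30 + i) = tree i) →
    (∀ v < n, s.arr 40 v = v) → (∀ e : Fin m, s.arr 3 e = lab e) →
    Runs distribute s (C * (n + m + 1)) fun s' =>
      ∃ fin : Fin n → Fin n, ChordInv src dst lab ord par tree m (s'.arr 3) fin := by
  refine ⟨(Prog.assign 2 (.const 0)).bound +
    ((Test.lt (.reg 2) (.reg 1)).cost + 1 + distributeBody.bound) * 1,
    fun n m src dst lab ord par tree s hin hset hord hpar htree hends hout => ?_⟩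
  have hin₀ : HasInput src dst lab (s.setReg 2 0) :=
    ⟨by simp [hin.n_eq], by simp [hin.m_eq], hin.src_eq, hin.dst_eq, hin.lab_eq⟩
  have harr : ∀ s', Frame distributeBody (s.setReg 2 0) s' → ∀ a, a ≠ 3 → a ≠ 40 →
      s'.arr a = s.arr a := by
    intro s' hf a h1 h2
    rw [hf.arr a (by simp [distributeBody, chordProg, chordEnds, chordMove, joinProg, incr,
      Prog.Writes, h1, h2])]
    rfl
  have hinp : ∀ s', Frame distributeBody (s.setReg 2 0) s' → HasInput src dst lab s' := fun s' hf =>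
    hin₀.frame hf
      (by simp [distributeBody, chordProg, chordEnds, chordMove, joinProg, incr, Prog.Writes])
      (by simp [distributeBody, chordProg, chordEnds, chordMove, joinProg, incr, Prog.Writes])
      (by simp [distributeBody, chordProg, chordEnds, chordMove, joinProg, incr, Prog.Writes])
      (by simp [distributeBody, chordProg, chordEnds, chordMove, joinProg, incr, Prog.Assigns])
      (by simp [distributeBody, chordProg, chordEnds, chordMove, joinProg, incr, Prog.Assigns])
  have key := Runs.loop (b := .lt (.reg 2) (.reg 1)) (p := distributeBody)
    (K := distributeBody.bound)
    (Inv := fun v s => v = m - s.reg 2 ∧ DistInv src dst lab ord par tree s)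
    (s₀ := s.setReg 2 0) (v := m) ?_ ?_
  · have := (Prog.LoopFree.runs (p := .assign 2 (.const 0)) (s := s) (Q := (· = s.setReg 2 0))
      trivial rfl).seq (q := .loop (.lt (.reg 2) (.reg 1)) distributeBody) fun s' hs' => by
        subst hs'; exact key
    refine this.mono (init_add_loop_le (by omega) (by omega)) ?_
    rintro s' ⟨hb, hf, v', -, hi⟩
    simp only [Test.Holds, Expr.eval, (hinp s' hf).m_eq] at hb
    have hm : s'.reg 2 = m := le_antisymm hi.le (by omega)
    obtain ⟨fin, -, h⟩ := hi.inv
    exact ⟨fin, hm ▸ h⟩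
  · rintro v s' hf ⟨rfl, hi⟩ hb
    simp only [Test.Holds, Expr.eval, (hinp s' hf).m_eq] at hb
    obtain ⟨h1, h2⟩ := hi.step (hinp s' hf) hset
      (fun i h => (harr s' hf _ (by omega) (by omega)).trans (hord i h))
      (fun i h => (harr s' hf _ (by omega) (by omega)).trans (hpar i h))
      (fun i h => (harr s' hf _ (by omega) (by omega)).trans (htree i h)) hb
    exact Prog.LoopFree.runs (by simp [distributeBody, chordProg, chordEnds, chordMove, joinProg,
      incr, Prog.LoopFree]) ⟨_, by rw [h2]; omega, rfl, h1⟩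
  · refine ⟨by simp, by simp, id, fun v => ?_, ?_⟩
    · simpa using hends v v.2
    · simpa using ChordInv.init hset hout

/-! ### Composition of the phases -/

theorem search_arr {i : ℕ} {s s' : Store} (h : Frame (search i) s s') {a : ℕ} (h9 : a ≠ 9)
    (h1 : a ≠ 10 + i) (h2 : a ≠ 20 + i) (h3 : a ≠ 30 + i) : s'.arr a = s.arr a :=
  h.arr a (by simp [search, searchInit, searchBody, scanProg, dequeueProg, rootProg, growProg,
    enqueueProg, incr, Prog.Writes, h9, h1, h2, h3])

theorem search_hasInput {i : ℕ} {s s' : Store} (h : Frame (search i) s s')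
    (hin : HasInput src dst lab s) : HasInput src dst lab s' := by
  have ha : ∀ a < 9, s'.arr a = s.arr a := fun a ha =>
    search_arr h (by omega) (by omega) (by omega) (by omega)
  have hr : ∀ r < 2, s'.reg r = s.reg r := by
    intro r hr
    apply h.reg
    simp [search, searchInit, searchBody, scanProg, dequeueProg, rootProg, growProg, enqueueProg,
      incr, Prog.Assigns]
    omega
  refine ⟨?_, ?_, ?_, ?_, ?_⟩
  · rw [hr 0 (by omega)]; exact hin.n_eq
  · rw [hr 1 (by omega)]; exact hin.m_eq
  · rw [ha 0 (by omega)]; exact hin.src_eq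
  · rw [ha 1 (by omega)]; exact hin.dst_eq
  · rw [ha 2 (by omega)]; exact hin.lab_eq

theorem search_lists {i : ℕ} {s s' : Store} (h : Frame (search i) s s') : s'.lists = s.lists := by
  have ha : ∀ a < 9, s'.arr a = s.arr a := fun a ha =>
    search_arr h (by omega) (by omega) (by omega) (by omega)
  simp [Store.lists, ha]

theorem convert_runs : ∃ C, ∀ (n m : ℕ) (src dst : Fin m → Fin n) (lab : Fin m → ℕ),
    (∀ e, src e ≠ dst e) → (∀ e e', s(src e, dst e) = s(src e', dst e') → e = e') →
    (∀ e, lab e < 3) → (∀ i < 3, IsPseudoforest (labGraph src dst lab i)) →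
    Runs convert (inputStore src dst lab) (C * (n + m + 1)) fun s' =>
      ∃ (ord par tree : ℕ → ℕ → ℕ) (fin : Fin n → Fin n), Setup src dst lab ord par tree ∧
        ChordInv src dst lab ord par tree m (s'.arr 3) fin := by
  obtain ⟨C₁, h₁⟩ := build_runs
  obtain ⟨C₂, h₂⟩ := initEnds_runs
  obtain ⟨C₃, h₃⟩ := search_runs 0
  obtain ⟨C₄, h₄⟩ := search_runs 1
  obtain ⟨C₅, h₅⟩ := search_runs 2
  obtain ⟨C₆, h₆⟩ := distribute_runs
  refine ⟨C₁ + (C₂ + (C₃ + (C₄ + (C₅ + C₆)))), fun n m src dst lab hne hinj hlab hP => ?_⟩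
  simp only [Nat.add_mul]
  refine (h₁ n m src dst lab).seq ?_
  rintro s₁ ⟨f₁, hv₁, hc₁, ho₁⟩
  -- The searches rely on their result arrays being zero at the start; the phases before them leave
  -- these untouched.
  have hw₁ : ∀ a, 8 < a → ∀ v, s₁.arr a v = 0 := by
    intro a ha v
    rw [f₁.arr a (by simp [build, buildBody, pushHalf, incr, Prog.Writes]; omega)]
    have : ∃ b, a = b + 3 := ⟨a - 3, by omega⟩
    obtain ⟨b, rfl⟩ := this
    rfl
  have i₁ : HasInput src dst lab s₁ := (hasInput_inputStore src dst lab).frame f₁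
      (by simp [build, buildBody, pushHalf, incr, Prog.Writes])
      (by simp [build, buildBody, pushHalf, incr, Prog.Writes])
      (by simp [build, buildBody, pushHalf, incr, Prog.Writes])
      (by simp [build, buildBody, pushHalf, incr, Prog.Assigns])
      (by simp [build, buildBody, pushHalf, incr, Prog.Assigns])
  refine (h₂ n m s₁ i₁.n_eq).seq ?_
  rintro s₂ ⟨f₂, hends⟩
  have a₂ : ∀ a, a ≠ 40 → s₂.arr a = s₁.arr a := fun a ha =>
    f₂.arr a (by simp [initEnds, initEndsBody, incr, Prog.Writes, ha])
  have i₂ : HasInput src dst lab s₂ := i₁.frame f₂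
      (by simp [initEnds, initEndsBody, incr, Prog.Writes])
      (by simp [initEnds, initEndsBody, incr, Prog.Writes])
      (by simp [initEnds, initEndsBody, incr, Prog.Writes])
      (by simp [initEnds, initEndsBody, incr, Prog.Assigns])
      (by simp [initEnds, initEndsBody, incr, Prog.Assigns])
  have l₂ : s₂.lists = s₁.lists := by simp [Store.lists, a₂]
  have z₂ : ∀ a, 8 < a → a ≠ 40 → ∀ v, s₂.arr a v = 0 := fun a h h' v => by
    rw [a₂ a h']; exact hw₁ a h v
  refine (h₃ n m src dst lab hne s₂ i₂ (l₂ ▸ hv₁) (l₂ ▸ hc₁) (z₂ _ (by omega) (by omega))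
    (z₂ _ (by omega) (by omega)) (z₂ _ (by omega) (by omega))).seq ?_
  rintro s₃ ⟨f₃, r₃⟩
  have i₃ := search_hasInput f₃ i₂
  have l₃ : s₃.lists = s₁.lists := (search_lists f₃).trans l₂
  have a₃ := fun a => @search_arr 0 s₂ s₃ f₃ a
  refine (h₄ n m src dst lab hne s₃ i₃ (l₃ ▸ hv₁) (l₃ ▸ hc₁)
    (by rw [a₃ _ (by omega) (by omega) (by omega) (by omega)]; exact z₂ _ (by omega) (by omega))
    (by rw [a₃ _ (by omega) (by omega) (by omega) (by omega)]; exact z₂ _ (by omega) (by omega))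
    (by rw [a₃ _ (by omega) (by omega) (by omega) (by omega)]; exact z₂ _ (by omega) (by omega))).seq
    ?_
  rintro s₄ ⟨f₄, r₄⟩
  have i₄ := search_hasInput f₄ i₃
  have l₄ : s₄.lists = s₁.lists := (search_lists f₄).trans l₃
  have a₄ := fun a => @search_arr 1 s₃ s₄ f₄ a
  have a₄' : ∀ a, a ≠ 9 → a ≠ 10 + 0 → a ≠ 20 + 0 → a ≠ 30 + 0 → a ≠ 10 + 1 → a ≠ 20 + 1 →
      a ≠ 30 + 1 → s₄.arr a = s₂.arr a := fun a h h1 h2 h3 h4 h5 h6 =>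
    (a₄ a h h4 h5 h6).trans (a₃ a h h1 h2 h3)
  refine (h₅ n m src dst lab hne s₄ i₄ (l₄ ▸ hv₁) (l₄ ▸ hc₁)
    (by rw [a₄' _ (by omega) (by omega) (by omega) (by omega) (by omega) (by omega) (by omega)]
        exact z₂ _ (by omega) (by omega))
    (by rw [a₄' _ (by omega) (by omega) (by omega) (by omega) (by omega) (by omega) (by omega)]
        exact z₂ _ (by omega) (by omega))
    (by rw [a₄' _ (by omega) (by omega) (by omega) (by omega) (by omega) (by omega) (by omega)]
        exact z₂ _ (by omega) (by omega))).seq ?_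
  rintro s₅ ⟨f₅, r₅⟩
  have i₅ := search_hasInput f₅ i₄
  have a₅ := fun a => @search_arr 2 s₄ s₅ f₅ a
  -- Each search writes only its own three result arrays and the queue, so the results of the
  -- earlier ones survive.
  have hset : Setup src dst lab (fun i => s₅.arr (10 + i)) (fun i => s₅.arr (20 + i))
      (fun i => s₅.arr (30 + i)) := by
    refine ⟨hne, hinj, hlab, hP, fun i hi => ?_⟩
    obtain rfl | rfl | rfl : i = 0 ∨ i = 1 ∨ i = 2 := by omega
    · have e : ∀ a, a = 10 + 0 ∨ a = 20 + 0 ∨ a = 30 + 0 → s₅.arr a = s₃.arr a := fun a ha =>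
        (a₅ a (by omega) (by omega) (by omega) (by omega)).trans
          (a₄ a (by omega) (by omega) (by omega) (by omega))
      simp only [e (10 + 0) (by omega), e (20 + 0) (by omega), e (30 + 0) (by omega)]
      exact r₃
    · have e : ∀ a, a = 10 + 1 ∨ a = 20 + 1 ∨ a = 30 + 1 → s₅.arr a = s₄.arr a := fun a ha =>
        a₅ a (by omega) (by omega) (by omega) (by omega)
      simp only [e (10 + 1) (by omega), e (20 + 1) (by omega), e (30 + 1) (by omega)]
      exact r₄
    · exact r₅
  have e₅ : ∀ a, a = 3 ∨ a = 40 → s₅.arr a = s₂.arr a := fun a ha =>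
    (a₅ a (by omega) (by omega) (by omega) (by omega)).trans
      (a₄' a (by omega) (by omega) (by omega) (by omega) (by omega) (by omega) (by omega))
  refine (h₆ n m src dst lab _ _ _ s₅ i₅ hset (fun _ _ => rfl) (fun _ _ => rfl) (fun _ _ => rfl)
    ?_ ?_).mono le_rfl fun s' ⟨fin, h⟩ => ⟨_, _, _, fin, hset, h⟩
  · rw [e₅ 40 (by omega)]; exact hends
  · rw [e₅ 3 (by omega), a₂ 3 (by omega)]; exact ho₁

end Distribute

/-! ### Translation between labelled edge lists and edge partitions -/

theorem labGraph_eq {n m k : ℕ} {G : SimpleGraph (Fin n)} {P : Fin k → SimpleGraph (Fin n)}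
    {src dst : Fin m → Fin n} {lab : Fin m → ℕ} (hG : IsEdgePartition G P)
    (hE : IsEdgeList G src dst) (hL : IsLabelling P src dst lab) (i : Fin k) :
    labGraph src dst lab i = P i := by
  ext x y
  constructor
  · rintro ⟨-, e, he, hs⟩
    have := (hL e i).1 he
    rwa [← mem_edgeSet, hs, mem_edgeSet] at this
  · intro h
    obtain ⟨e, hs, -⟩ := hE.existsUnique s(x, y) (hG.le i h)
    refine ⟨h.ne, e, (hL e i).2 ?_, hs⟩
    rw [← mem_edgeSet, hs]
    exact h

theorem isEdgePartition_outGraph {n m k : ℕ} {G : SimpleGraph (Fin n)} {src dst : Fin m → Fin n}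
    (hE : IsEdgeList G src dst) {out : ℕ → ℕ} (hout : ∀ e : Fin m, out e < k) :
    IsEdgePartition G fun j : Fin k => outGraph src dst out j where
  le j x y := by
    rintro ⟨-, e, -, hs⟩
    have := hE.adj e
    rwa [← mem_edgeSet, hs] at this
  existsUnique x y h := by
    obtain ⟨e, hs, hu⟩ := hE.existsUnique s(x, y) h
    refine ⟨⟨out e, hout e⟩, ⟨h.ne, e, rfl, hs⟩, ?_⟩
    rintro j ⟨-, f, hf, hs'⟩
    obtain rfl := hu f hs'
    exact Fin.ext hf.symm

theorem isLabelling_outGraph {n m k : ℕ} {G : SimpleGraph (Fin n)} {src dst : Fin m → Fin n}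
    (hE : IsEdgeList G src dst) (out : ℕ → ℕ) :
    IsLabelling (fun j : Fin k => outGraph src dst out j) src dst fun e => out e := by
  intro e j
  constructor
  · exact fun h => ⟨(hE.adj e).ne, e, h, rfl⟩
  · rintro ⟨-, f, hf, hs⟩
    obtain ⟨_, -, hu⟩ := hE.existsUnique s(src e, dst e) (hE.adj e)
    rw [hu e rfl, ← hu f hs]
    exact hf

end PseudoConv

theorem mainTheorem7 :
    ∃ (prog : PseudoConv.Prog) (C : ℕ),
      ∀ (n m : ℕ) (G : SimpleGraph (Fin n)) (P : Fin 3 → SimpleGraph (Fin n)),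
        PseudoConv.IsEdgePartition G P →
        (∀ i, PseudoConv.IsPseudoforest (P i)) →
        ∀ (src dst : Fin m → Fin n) (lab : Fin m → ℕ),
          PseudoConv.IsEdgeList G src dst →
          PseudoConv.IsLabelling P src dst lab →
          ∃ (t : ℕ) (s : PseudoConv.Store) (F : Fin 5 → SimpleGraph (Fin n)),
            PseudoConv.Exec prog (PseudoConv.inputStore src dst lab) t s ∧
            t ≤ C * (n + m + 1) ∧
            PseudoConv.IsEdgePartition G F ∧
            (∀ j, (F j).IsAcyclic) ∧
            PseudoConv.IsLinearForest (F 3) ∧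
            PseudoConv.IsLinearForest (F 4) ∧
            PseudoConv.IsLabelling F src dst (PseudoConv.outputLabels m s) := by
  obtain ⟨C, hC⟩ := PseudoConv.convert_runs
  refine ⟨PseudoConv.convert, C, fun n m G P hG hP src dst lab hE hL => ?_⟩
  -- `IsLabelling` does not bound the labels by itself: the bound comes from the part that contains
  -- the edge.
  have hlab : ∀ e, lab e < 3 := by
    intro e
    obtain ⟨i, hi, -⟩ := hG.existsUnique _ _ (hE.adj e)
    rw [(hL e i).2 hi]
    exact i.2
  have hinj : ∀ e e', s(src e, dst e) = s(src e', dst e') → e = e' := by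
    intro e e' h
    obtain ⟨_, -, hu⟩ := hE.existsUnique s(src e, dst e) (hE.adj e)
    rw [hu e rfl, hu e' h.symm]
  obtain ⟨t, s, hexec, ht, ord, par, tree, fin, hset, hinv⟩ :=
    hC n m src dst lab (fun e => (hE.adj e).ne) hinj hlab fun i hi => by
      rw [PseudoConv.labGraph_eq hG hE hL ⟨i, hi⟩]; exact hP _
  have hout : ∀ e : Fin m, s.arr 3 e < 5 := by
    intro e
    have := hlab e
    rcases hinv.out_cases e with h | h | h <;> omega
  refine ⟨t, s, fun j => PseudoConv.outGraph src dst (s.arr 3) j, hexec, ht,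
    PseudoConv.isEdgePartition_outGraph hE hout, ?_, hinv.isLinearForest_three,
    hinv.isLinearForest_four hset, PseudoConv.isLabelling_outGraph hE _⟩
  intro j
  fin_cases j
  · exact hinv.isAcyclic_of_lt_two hset (c := 0) (by omega)
  · exact hinv.isAcyclic_of_lt_two hset (c := 1) (by omega)
  · exact hinv.isAcyclic_two hset
  · exact hinv.isLinearForest_three.1
  · exact (hinv.isLinearForest_four hset).1
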